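/- All manifolds are real, smooth, finite-dimensional, Hausdorff, second countable and without boundary. Let $\pi:P\to X$ be a smooth principal bundle whose structure group is a Lie group $G$ acting on $P$ on the right, let $H\subset G$ be a closed (hence Lie) subgroup, and let $\mathfrak h\subset\mathfrak g$ be their Lie algebras. Let $\Sigma=P/H$ be the quotient manifold with projection $q:P\to\Sigma$. Let $V$ be a manifold with a smooth left action of $H$, and let $Y=(P\times V)/H$, where $(p,v)\sim(pk,k^{-1}v)$ for $k\in H$, be the associated bundle over $\Sigma$. A connection on a fibred manifold $E\to B$ is a smooth family of projectors $\mathrm{hor}_y:T_yE\to T_yE$, $y\in E$, whose kernel is the vertical space at $y$. For a Lie group $K$, a $K$-connection on a principal $K$-bundle is a connection that commutes with the differentials of the right translations; its connection form at $p$ sends $w$ to the element $\zeta$ of the Lie algebra of $K$ whose fundamental vector at $p$ is $w-\mathrm{hor}_p(w)$. A $K$-connection on $Q\to B$ induces on $(Q\times V)/K\to B$ the associated connection, for which the horizontal part of the image of $(w,u)\in T_qQ\times T_vV$ is the image of $(\mathrm{hor}_q(w),0)$. Assume that $\mathfrak g=\mathfrak h\oplus\mathfrak f$ for a linear subspace $\mathfrak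 f$ with $[\mathfrak h,\mathfrak f]\subset\mathfrak f$, and that every connected component of $H$ contains an element $k$ with $\mathrm{Ad}(k)\mathfrak f\subset\mathfrak f$ (this is automatic if $H$ is connected). Let $A$ be a $G$-connection on $P\to X$. Then there are an $H$-connection $A_\Sigma$ on the principal $H$-bundle $q:P\to\Sigma$, whose connection form is the $\mathfrak h$-component, with respect to $\mathfrak h\oplus\mathfrak f$, of the connection form of $A$, and its associated connection $A_{Y\Sigma}$ on $Y\to\Sigma$, with the following property. For every Higgs field, that is, every smooth global section $h$ of $P/H\to X$, let $P^h=q^{-1}(h(X))$, an embedded submanifold of $P$ and a principal $H$-bundle over $X$, and let $Y^h=(P^h\times V)/H=h^*Y$ be the $P^h$-associated bundle over $X$. Then 1. the restriction to $P^h$ of the $\mathfrak h$-component of the connection form of $A$ is the connection form of an $H$-connection $\overline A_h$ on $P^h\to X$; 2. the pull-back of $A_\Sigma$ to $P^h$ is $\overline A_h$; 3. the pull-back $h^*A_{Y\Sigma}$ to $Y^h$ coincides with the connection on $Y^h\to X$ associated to $\overline A_h$. -/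

import Mathlib

open scoped Manifold ContDiff RightActions Topology

/-!
All manifolds are real, finite dimensional, smooth and without boundary: a manifold `M` is charted
on a normed space `E` with the model `𝓘(ℝ, E)`. A right action of `K` on `Q` is an action of `Kᵐᵒᵖ`,
and `q <• k` is the result of acting by `k` on the right of `q`.
-/

noncomputable section

namespace HiggsGauge

/-! ### Principal bundles -/

/-- `π : Q → B` is a smooth principal `K`-bundle: `K` acts smoothly and freely on the right of `Q`,
the map `π` is smooth and invariant, and around every point of `B` there is a smooth local section
`z` whose trivialization `q ↦ (π q, τ q)`, where `q = z (π q) <• τ q`, is smooth. In particular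
`π` is surjective and `K` acts transitively on its fibres. -/
structure IsPrincipalBundle (EK EQ EB : Type*)
    [NormedAddCommGroup EK] [NormedSpace ℝ EK] [NormedAddCommGroup EQ] [NormedSpace ℝ EQ]
    [NormedAddCommGroup EB] [NormedSpace ℝ EB]
    (K : Type*) [Group K] [TopologicalSpace K] [ChartedSpace EK K]
    {Q : Type*} [TopologicalSpace Q] [ChartedSpace EQ Q] [MulAction Kᵐᵒᵖ Q]
    {B : Type*} [TopologicalSpace B] [ChartedSpace EB B] (π : Q → B) : Prop where
  contMDiff_act : ContMDiff (𝓘(ℝ, EQ).prod 𝓘(ℝ, EK)) 𝓘(ℝ, EQ) ∞ (fun z : Q × K => z.1 <• z.2)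
  contMDiff_proj : ContMDiff 𝓘(ℝ, EQ) 𝓘(ℝ, EB) ∞ π
  proj_act : ∀ (q : Q) (k : K), π (q <• k) = π q
  free : ∀ (q : Q) (k : K), q <• k = q → k = 1
  locally_trivial : ∀ b : B, ∃ U : Set B, IsOpen U ∧ b ∈ U ∧ ∃ (z : B → Q) (τ : Q → K),
    ContMDiffOn 𝓘(ℝ, EB) 𝓘(ℝ, EQ) ∞ z U ∧
    ContMDiffOn 𝓘(ℝ, EQ) 𝓘(ℝ, EK) ∞ τ (π ⁻¹' U) ∧
    (∀ x ∈ U, π (z x) = x) ∧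
    (∀ q ∈ π ⁻¹' U, z (π q) <• τ q = q)

/-! ### Connections -/

/-- A connection on a fibred manifold `π : Y → B`, given by its horizontal projectors:
`hor y` is the projection of `T_y Y` along the vertical space `ker (dπ_y)` onto a complement of it
(the horizontal space), and it depends smoothly on `y`. Equivalently `hor y = Γ_y ∘ dπ_y` with
`Γ_y : T_{π y} B → T_y Y` a linear right inverse of `dπ_y`, that is, with a `1`-jet of a section. -/
structure Conn (EY EB : Type*)
    [NormedAddCommGroup EY] [NormedSpace ℝ EY] [NormedAddCommGroup EB] [NormedSpace ℝ EB]
    {Y : Type*} [TopologicalSpace Y] [ChartedSpace EY Y] [IsManifold 𝓘(ℝ, EY) ∞ Y]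
    {B : Type*} [TopologicalSpace B] [ChartedSpace EB B] (π : Y → B) where
  hor : ∀ y : Y, TangentSpace 𝓘(ℝ, EY) y →L[ℝ] TangentSpace 𝓘(ℝ, EY) y
  proj_hor : ∀ (y : Y) (w : TangentSpace 𝓘(ℝ, EY) y),
    mfderiv 𝓘(ℝ, EY) 𝓘(ℝ, EB) π y (hor y w) = mfderiv 𝓘(ℝ, EY) 𝓘(ℝ, EB) π y w
  hor_vertical : ∀ (y : Y) (w : TangentSpace 𝓘(ℝ, EY) y),
    mfderiv 𝓘(ℝ, EY) 𝓘(ℝ, EB) π y w = 0 → hor y w = 0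
  smooth : ContMDiff 𝓘(ℝ, EY).tangent 𝓘(ℝ, EY).tangent ∞
    (fun w : TangentBundle 𝓘(ℝ, EY) Y => (⟨w.proj, hor w.proj w.snd⟩ : TangentBundle 𝓘(ℝ, EY) Y))

/-- A `K`-connection: a connection on `π : Q → B` that is equivariant under the right action
of `K` on `Q`. -/
structure PrincipalConn (EQ EB : Type*)
    [NormedAddCommGroup EQ] [NormedSpace ℝ EQ] [NormedAddCommGroup EB] [NormedSpace ℝ EB]
    (K : Type*) [Group K]
    {Q : Type*} [TopologicalSpace Q] [ChartedSpace EQ Q] [IsManifold 𝓘(ℝ, EQ) ∞ Q]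
    [MulAction Kᵐᵒᵖ Q]
    {B : Type*} [TopologicalSpace B] [ChartedSpace EB B] (π : Q → B)
    extends Conn EQ EB π where
  equivariant : ∀ (k : K) (q : Q) (w : TangentSpace 𝓘(ℝ, EQ) q),
    mfderiv 𝓘(ℝ, EQ) 𝓘(ℝ, EQ) (fun q' : Q => q' <• k) q (hor q w) =
      hor (q <• k) (mfderiv 𝓘(ℝ, EQ) 𝓘(ℝ, EQ) (fun q' : Q => q' <• k) q w)

/-- For a map of fibred manifolds `j : Y' → Y` covering a map `B' → B` and identifying `Y' → B'`
with the pull-back bundle, the connection `Γ'` is the pull-back of `Γ`: the horizontal part of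
`w ∈ T Y'` is sent by `dj` to the horizontal part of `dj w`. -/
def IsPullbackConn {EY EB EY' EB' : Type*}
    [NormedAddCommGroup EY] [NormedSpace ℝ EY] [NormedAddCommGroup EB] [NormedSpace ℝ EB]
    [NormedAddCommGroup EY'] [NormedSpace ℝ EY'] [NormedAddCommGroup EB'] [NormedSpace ℝ EB']
    {Y : Type*} [TopologicalSpace Y] [ChartedSpace EY Y] [IsManifold 𝓘(ℝ, EY) ∞ Y]
    {B : Type*} [TopologicalSpace B] [ChartedSpace EB B] {π : Y → B}
    {Y' : Type*} [TopologicalSpace Y'] [ChartedSpace EY' Y'] [IsManifold 𝓘(ℝ, EY') ∞ Y']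
    {B' : Type*} [TopologicalSpace B'] [ChartedSpace EB' B'] {π' : Y' → B'}
    (j : Y' → Y) (Γ : Conn EY EB π) (Γ' : Conn EY' EB' π') : Prop :=
  ∀ (y : Y') (w : TangentSpace 𝓘(ℝ, EY') y),
    mfderiv 𝓘(ℝ, EY') 𝓘(ℝ, EY) j y (Γ'.hor y w) =
      Γ.hor (j y) (mfderiv 𝓘(ℝ, EY') 𝓘(ℝ, EY) j y w)

/-! ### Orbit spaces and associated bundles -/

/-- The equivalence relation of being in the same orbit of a right action. -/
def orbitSetoid (K Q : Type*) [Group K] [MulAction Kᵐᵒᵖ Q] : Setoid Q where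
  r q q' := ∃ k : K, q' = q <• k
  iseqv :=
    { refl := fun q => ⟨1, by simp⟩
      symm := by
        rintro q _ ⟨k, rfl⟩
        exact ⟨k⁻¹, by simp⟩
      trans := by
        rintro q _ _ ⟨k, rfl⟩ ⟨l, rfl⟩
        exact ⟨k * l, by simp [mul_smul]⟩ }

/-- The orbit space `Q/K` with the quotient topology. -/
abbrev OrbitSpace (K Q : Type*) [Group K] [MulAction Kᵐᵒᵖ Q] : Type _ :=
  Quotient (orbitSetoid K Q)

/-- The projection `Q → Q/K`. -/
def orbitMk (K : Type*) {Q : Type*} [Group K] [MulAction Kᵐᵒᵖ Q] (q : Q) : OrbitSpace K Q :=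
  Quotient.mk (orbitSetoid K Q) q

theorem orbitMk_act {K Q : Type*} [Group K] [MulAction Kᵐᵒᵖ Q] (q : Q) (k : K) :
    orbitMk K (q <• k) = orbitMk K q :=
  (Quotient.sound (s := orbitSetoid K Q) ⟨k, rfl⟩).symm

/-- The equivalence relation `(q, v) ∼ (q k, k⁻¹ v)` on `Q × V`. -/
def assocSetoid (K Q V : Type*) [Group K] [MulAction Kᵐᵒᵖ Q] [MulAction K V] :
    Setoid (Q × V) where
  r a b := ∃ k : K, b = (a.1 <• k, k⁻¹ • a.2)
  iseqv :=
    { refl := fun a => ⟨1, by simp⟩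
      symm := by
        rintro a _ ⟨k, rfl⟩
        exact ⟨k⁻¹, by simp⟩
      trans := by
        rintro a _ _ ⟨k, rfl⟩ ⟨l, rfl⟩
        exact ⟨k * l, by simp [mul_smul]⟩ }

/-- The associated bundle `(Q × V)/K` with the quotient topology. -/
abbrev Assoc (K Q V : Type*) [Group K] [MulAction Kᵐᵒᵖ Q] [MulAction K V] : Type _ :=
  Quotient (assocSetoid K Q V)

/-- The projection `Q × V → (Q × V)/K`. -/
def assocMk (K : Type*) {Q V : Type*} [Group K] [MulAction Kᵐᵒᵖ Q] [MulAction K V] (a : Q × V) :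
    Assoc K Q V :=
  Quotient.mk (assocSetoid K Q V) a

/-- The projection `(Q × V)/K → B`, `[q, v] ↦ π q`, for an invariant map `π : Q → B`. -/
def assocProj {K Q : Type*} (V : Type*) [Group K] [MulAction Kᵐᵒᵖ Q] [MulAction K V] {B : Type*}
    (π : Q → B) (hπ : ∀ (q : Q) (k : K), π (q <• k) = π q) : Assoc K Q V → B :=
  Quotient.lift (fun a : Q × V => π a.1) (by
    rintro a _ ⟨k, rfl⟩
    exact (hπ a.1 k).symm)

/-- The map `(Q' × V)/K → (Q × V)/K`, `[q, v] ↦ [i q, v]`, for an equivariant map `i : Q' → Q`. -/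
def assocMap {K Q Q' : Type*} (V : Type*) [Group K] [MulAction Kᵐᵒᵖ Q] [MulAction Kᵐᵒᵖ Q']
    [MulAction K V] (i : Q' → Q) (hi : ∀ (q : Q') (k : K), i (q <• k) = i q <• k) :
    Assoc K Q' V → Assoc K Q V :=
  Quotient.map (fun a : Q' × V => (i a.1, a.2)) (by
    rintro a _ ⟨k, rfl⟩
    exact ⟨k, by simp [hi]⟩)

/-- `Γ` is the connection on `(Q × V)/K → B` associated to the connection `α` on `Q → B`: the
horizontal part of the image of `(w, u) ∈ T_q Q × T_v V` is the image of `(hor w, 0)`. -/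
def IsAssociatedConn {EQ EB EV EY : Type*}
    [NormedAddCommGroup EQ] [NormedSpace ℝ EQ] [NormedAddCommGroup EB] [NormedSpace ℝ EB]
    [NormedAddCommGroup EV] [NormedSpace ℝ EV] [NormedAddCommGroup EY] [NormedSpace ℝ EY]
    {K : Type*} [Group K]
    {Q : Type*} [TopologicalSpace Q] [ChartedSpace EQ Q] [IsManifold 𝓘(ℝ, EQ) ∞ Q]
    [MulAction Kᵐᵒᵖ Q]
    {V : Type*} [TopologicalSpace V] [ChartedSpace EV V] [MulAction K V]
    {B : Type*} [TopologicalSpace B] [ChartedSpace EB B] {π : Q → B}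
    {hπ : ∀ (q : Q) (k : K), π (q <• k) = π q}
    [ChartedSpace EY (Assoc K Q V)] [IsManifold 𝓘(ℝ, EY) ∞ (Assoc K Q V)]
    (α : PrincipalConn EQ EB K π) (Γ : Conn EY EB (assocProj V π hπ)) : Prop :=
  ∀ (q : Q) (v : V) (w : TangentSpace 𝓘(ℝ, EQ) q) (u : TangentSpace 𝓘(ℝ, EV) v),
    Γ.hor (assocMk K (q, v))
        (mfderiv (𝓘(ℝ, EQ).prod 𝓘(ℝ, EV)) 𝓘(ℝ, EY) (assocMk K) (q, v) (w, u)) =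
      mfderiv (𝓘(ℝ, EQ).prod 𝓘(ℝ, EV)) 𝓘(ℝ, EY) (assocMk K) (q, v)
        (α.hor q w, (0 : TangentSpace 𝓘(ℝ, EV) v))

/-! ### Lie algebras -/

/-- The Lie algebra of a Lie subgroup `H` of `G`, as a subspace of the Lie algebra of `G`. -/
def subgroupLieAlgebra (EG EH : Type*)
    [NormedAddCommGroup EG] [NormedSpace ℝ EG] [NormedAddCommGroup EH] [NormedSpace ℝ EH]
    {G : Type*} [Group G] [TopologicalSpace G] [ChartedSpace EG G]
    (H : Subgroup G) [ChartedSpace EH H] : Submodule ℝ (GroupLieAlgebra 𝓘(ℝ, EG) G) :=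
  LinearMap.range
    (mfderiv 𝓘(ℝ, EH) 𝓘(ℝ, EG) (Subtype.val : H → G) (1 : H) :
      GroupLieAlgebra 𝓘(ℝ, EH) H →L[ℝ] GroupLieAlgebra 𝓘(ℝ, EG) G).toLinearMap

/-- The adjoint representation: `Ad g` is the differential at `1` of `x ↦ g x g⁻¹`. -/
def Ad (EG : Type*) [NormedAddCommGroup EG] [NormedSpace ℝ EG]
    {G : Type*} [Group G] [TopologicalSpace G] [ChartedSpace EG G] (g : G) :
    GroupLieAlgebra 𝓘(ℝ, EG) G → GroupLieAlgebra 𝓘(ℝ, EG) G :=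
  fun ξ => mfderiv 𝓘(ℝ, EG) 𝓘(ℝ, EG) (fun x : G => g * x * g⁻¹) 1 ξ

/-- The value at `p` of the fundamental vector field of `ξ`: the differential at `1` of
`g ↦ p <• g`, applied to `ξ`. -/
def fundVec (EG EP : Type*)
    [NormedAddCommGroup EG] [NormedSpace ℝ EG] [NormedAddCommGroup EP] [NormedSpace ℝ EP]
    {G : Type*} [Group G] [TopologicalSpace G] [ChartedSpace EG G]
    {P : Type*} [TopologicalSpace P] [ChartedSpace EP P] [MulAction Gᵐᵒᵖ P]
    (p : P) (ξ : GroupLieAlgebra 𝓘(ℝ, EG) G) : TangentSpace 𝓘(ℝ, EP) p :=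
  mfderiv 𝓘(ℝ, EG) 𝓘(ℝ, EP) (fun g : G => p <• g) 1 ξ

/-- Let `A` be a connection on `π : P → X`, let `i : Q → P` be a map and `α` a connection on
`ϖ : Q → B`. The connection form of `A` at `p` sends a vector to the `ζ` whose fundamental vector
at `p` is the vertical part of that vector. The statement is that the connection form of `α` is the
pull-back along `i` of the `𝔥`-valued constituent, with respect to `𝔥 ⊕ 𝔣`, of the connection form
of `A`. -/
def IsConstituentConn {EG EP EX EQ EB : Type*}
    [NormedAddCommGroup EG] [NormedSpace ℝ EG] [NormedAddCommGroup EP] [NormedSpace ℝ EP]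
    [NormedAddCommGroup EX] [NormedSpace ℝ EX] [NormedAddCommGroup EQ] [NormedSpace ℝ EQ]
    [NormedAddCommGroup EB] [NormedSpace ℝ EB]
    {G : Type*} [Group G] [TopologicalSpace G] [ChartedSpace EG G]
    (𝔥 𝔣 : Submodule ℝ (GroupLieAlgebra 𝓘(ℝ, EG) G))
    {P : Type*} [TopologicalSpace P] [ChartedSpace EP P] [IsManifold 𝓘(ℝ, EP) ∞ P]
    [MulAction Gᵐᵒᵖ P]
    {X : Type*} [TopologicalSpace X] [ChartedSpace EX X] {π : P → X}
    {Q : Type*} [TopologicalSpace Q] [ChartedSpace EQ Q] [IsManifold 𝓘(ℝ, EQ) ∞ Q]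
    {B : Type*} [TopologicalSpace B] [ChartedSpace EB B] {ϖ : Q → B}
    (A : Conn EP EX π) (i : Q → P) (α : Conn EQ EB ϖ) : Prop :=
  ∀ (q : Q) (w : TangentSpace 𝓘(ℝ, EQ) q), ∃ ξ ∈ 𝔥, ∃ η ∈ 𝔣,
    mfderiv 𝓘(ℝ, EQ) 𝓘(ℝ, EP) i q w - A.hor (i q) (mfderiv 𝓘(ℝ, EQ) 𝓘(ℝ, EP) i q w) =
      fundVec EG EP (i q) (ξ + η) ∧
    mfderiv 𝓘(ℝ, EQ) 𝓘(ℝ, EP) i q (w - α.hor q w) = fundVec EG EP (i q) ξ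

/-! ### Higgs fields and reduced subbundles -/

/-- The right action of a subgroup `H` of `G` on a space with a right action of `G`. -/
instance subgroupAct {G P : Type*} [Group G] [MulAction Gᵐᵒᵖ P] (H : Subgroup G) :
    MulAction (↥H)ᵐᵒᵖ P :=
  MulAction.compHom P (MonoidHom.op H.subtype)

theorem subgroup_act_def {G P : Type*} [Group G] [MulAction Gᵐᵒᵖ P] (H : Subgroup G)
    (p : P) (k : H) : p <• k = p <• (k : G) :=
  rfl

/-- The projection `P/H → X` induced by an invariant map `π : P → X`. -/
def quotProj {G P X : Type*} [Group G] [MulAction Gᵐᵒᵖ P] (H : Subgroup G) (π : P → X)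
    (hπ : ∀ (p : P) (g : G), π (p <• g) = π p) : OrbitSpace H P → X :=
  Quotient.lift π (by
    rintro p _ ⟨k, rfl⟩
    exact (hπ p k).symm)

/-- A Higgs field: a smooth global section of `P/H → X`. -/
structure HiggsField (EX ES : Type*)
    [NormedAddCommGroup EX] [NormedSpace ℝ EX] [NormedAddCommGroup ES] [NormedSpace ℝ ES]
    {G : Type*} [Group G] (H : Subgroup G)
    {P : Type*} [TopologicalSpace P] [MulAction Gᵐᵒᵖ P]
    {X : Type*} [TopologicalSpace X] [ChartedSpace EX X] [ChartedSpace ES (OrbitSpace H P)]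
    (π : P → X) (hπ : ∀ (p : P) (g : G), π (p <• g) = π p) where
  toFun : X → OrbitSpace H P
  smooth : ContMDiff 𝓘(ℝ, EX) 𝓘(ℝ, ES) ∞ toFun
  isSection : ∀ x : X, quotProj H π hπ (toFun x) = x

/-- The reduced subbundle `P^h`: the preimage of `h(X)` under `P → P/H`, for `h : X → P/H`. -/
abbrev Reduced {G P X : Type*} [Group G] [MulAction Gᵐᵒᵖ P] (H : Subgroup G)
    (h : X → OrbitSpace H P) : Type _ :=
  ↥((orbitMk H : P → OrbitSpace H P) ⁻¹' Set.range h)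

/-- The right action of `H` on the reduced subbundle. -/
instance reducedAct {G P X : Type*} [Group G] [MulAction Gᵐᵒᵖ P] (H : Subgroup G)
    (h : X → OrbitSpace H P) : MulAction (↥H)ᵐᵒᵖ (Reduced H h) where
  smul k p := ⟨k • p.1, by
    have e : orbitMk H (k • p.1) = orbitMk H p.1 := orbitMk_act p.1 k.unop
    simpa only [Set.mem_preimage, e] using p.2⟩
  one_smul p := Subtype.ext (one_smul _ p.1)
  mul_smul k l p := Subtype.ext (mul_smul k l p.1)

theorem reduced_val_act {G P X : Type*} [Group G] [MulAction Gᵐᵒᵖ P] (H : Subgroup G)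
    (h : X → OrbitSpace H P) (p : Reduced H h) (k : H) :
    (Subtype.val (p <• k) : P) = p.1 <• k :=
  rfl

/-- The projection `P^h → X`. -/
def reducedProj {G P X : Type*} [Group G] [MulAction Gᵐᵒᵖ P] (H : Subgroup G)
    (h : X → OrbitSpace H P) (π : P → X) : Reduced H h → X :=
  fun p => π p.1

theorem reducedProj_act {G P X : Type*} [Group G] [MulAction Gᵐᵒᵖ P] (H : Subgroup G)
    (h : X → OrbitSpace H P) (π : P → X) (hπ : ∀ (p : P) (g : G), π (p <• g) = π p)
    (p : Reduced H h) (k : H) : reducedProj H h π (p <• k) = reducedProj H h π p :=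
  hπ p.1 k

end HiggsGauge

end

open HiggsGauge Manifold

/-! Let ϑ be the connection form of A and σ : 𝔤 → 𝔥 the projection along 𝔣. Everything comes from
the single form θ = σ ∘ ϑ on P. It reproduces the fundamental vectors of H because ϑ reproduces
those of G, and it is H-equivariant once σ commutes with Ad(H), which holds because Ad(H) preserves
𝔣 (`PrincipalConn.exists_constituent_form`).

The bracket condition gives this invariance (`adMap_mem_of_bracket_mem`). The derivative of Ad at
the identity is ad (`modelDeriv_adMap_one`), so the part of Ad(k)|𝔣 that leaves 𝔣 solves a
homogeneous linear differential equation in k. By uniqueness the closed set of those k that preserve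
𝔣 is also open, and by assumption it meets every component of H.

Let i : Q → P be an H-equivariant immersion whose differential sends vertical vectors of Q → B to
fundamental vectors of H. Subtracting from w the fundamental vector of θ(di w) then defines an
H-connection on Q → B (`exists_principalConn_of_connForm`). With i = id this is the connection on P
→ P/H, whose vertical vectors are fundamental by
`exists_modelFund_eq_of_modelDeriv_orbitMk_eq_zero`. With i the inclusion of P^h it is the
connection on P^h → X: on P^h the map q equals h ∘ π, so a vector vertical over X is vertical over
P/H. The two projectors have the same formula, hence one connection is the pull-back of the other.

An associated connection is the horizontal projector of Q pushed through the submersion Q × V → (Q ×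
V)/H (`exists_associatedConn`). This is natural in Q, so pull-backs of principal connections induce
pull-backs of associated ones (`IsPullbackConn.assoc`).

Derivatives are read in the model spaces, so that base points can be replaced by equal ones without
transport. -/

noncomputable section

namespace HiggsGauge

open Set Filter Bundle

/-! ### Derivatives read in the model spaces -/

section ModelDeriv

variable {E E' E'' F F' F'' M M' M'' : Type*}
  [NormedAddCommGroup E] [NormedSpace ℝ E] [TopologicalSpace F] {I : ModelWithCorners ℝ E F}
  [TopologicalSpace M] [ChartedSpace F M]
  [NormedAddCommGroup E'] [NormedSpace ℝ E'] [TopologicalSpace F'] {I' : ModelWithCorners ℝ E' F'}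
  [TopologicalSpace M'] [ChartedSpace F' M']
  [NormedAddCommGroup E''] [NormedSpace ℝ E''] [TopologicalSpace F'']
  {I'' : ModelWithCorners ℝ E'' F''} [TopologicalSpace M''] [ChartedSpace F'' M'']

variable (I I') in
/-- The derivative of a map between manifolds, as a map between the model spaces. This is `mfderiv`
with the dependence of the tangent spaces on the base point forgotten. -/
def modelDeriv (f : M → M') (x : M) : E →L[ℝ] E' := mfderiv I I' f x

theorem modelDeriv_comp {g : M' → M''} {f : M → M'} {x : M} {y : M'}
    (hg : MDifferentiableAt I' I'' g y) (hf : MDifferentiableAt I I' f x) (hy : f x = y) :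
    modelDeriv I I'' (fun a => g (f a)) x = (modelDeriv I' I'' g y).comp (modelDeriv I I' f x) := by
  subst hy
  exact mfderiv_comp x hg hf

theorem modelDeriv_comp_apply {g : M' → M''} {f : M → M'} {x : M} {y : M'}
    (hg : MDifferentiableAt I' I'' g y) (hf : MDifferentiableAt I I' f x) (hy : f x = y) (w : E) :
    modelDeriv I I'' (fun a => g (f a)) x w = modelDeriv I' I'' g y (modelDeriv I I' f x w) := by
  rw [modelDeriv_comp hg hf hy]
  rfl

theorem modelDeriv_congr {f g : M → M'} {x : M} (h : f =ᶠ[𝓝 x] g) :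
    modelDeriv I I' f x = modelDeriv I I' g x :=
  h.mfderiv_eq

theorem modelDeriv_const (c : M') (x : M) : modelDeriv I I' (fun _ : M => c) x = 0 :=
  mfderiv_const

theorem modelDeriv_id (x : M) : modelDeriv I I (fun y : M => y) x = ContinuousLinearMap.id ℝ E :=
  mfderiv_id

theorem modelDeriv_prodMk {f : M → M'} {g : M → M''} {x : M} (hf : MDifferentiableAt I I' f x)
    (hg : MDifferentiableAt I I'' g x) (w : E) :
    modelDeriv I (I'.prod I'') (fun a => (f a, g a)) x w =
      (modelDeriv I I' f x w, modelDeriv I I'' g x w) := by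
  have := hf.mfderiv_prod hg
  exact congrArg (fun L : E →L[ℝ] E' × E'' => L w) this

theorem modelDeriv_prod {f : M × M' → M''} {x : M} {y : M'}
    (hf : MDifferentiableAt (I.prod I') I'' f (x, y)) (u : E) (v : E') :
    modelDeriv (I.prod I') I'' f (x, y) (u, v) =
      modelDeriv I I'' (fun a => f (a, y)) x u + modelDeriv I' I'' (fun b => f (x, b)) y v :=
  mfderiv_prod_eq_add_apply (v := ((u, v) : E × E')) hf

theorem modelDeriv_fst (x : M × M') (w : E × E') :
    modelDeriv (I.prod I') I (Prod.fst : M × M' → M) x w = w.1 := by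
  have : modelDeriv (I.prod I') I (Prod.fst : M × M' → M) x = ContinuousLinearMap.fst ℝ E E' :=
    mfderiv_fst
  rw [this]; rfl

theorem modelDeriv_snd (x : M × M') (w : E × E') :
    modelDeriv (I.prod I') I' (Prod.snd : M × M' → M') x w = w.2 := by
  have : modelDeriv (I.prod I') I' (Prod.snd : M × M' → M') x = ContinuousLinearMap.snd ℝ E E' :=
    mfderiv_snd
  rw [this]; rfl

/-- The point of the tangent bundle with the given base point and vector of the model space. -/
def tangentMk (I : ModelWithCorners ℝ E F) (x : M) (w : E) : TangentBundle I M :=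
  ⟨x, w⟩

/-- The vector of the model space that underlies a point of the tangent bundle. -/
def modelVec (w : TangentBundle I M) : E := w.2

/-- On an open set `tangentMapWithin` is the full tangent map. Smoothness of a connection is
smoothness of a map of tangent bundles; this form reduces it to smoothness of maps between the
manifolds. -/
theorem contMDiffAt_tangentMap [IsManifold I ∞ M] [IsManifold I' ∞ M'] {f : M → M'} {U : Set M}
    (hU : IsOpen U) (hf : ContMDiffOn I I' ∞ f U) {w : TangentBundle I M} (hw : w.proj ∈ U) :
    ContMDiffAt I.tangent I'.tangent ∞
      (fun v : TangentBundle I M => tangentMk I' (f v.proj) (modelDeriv I I' f v.proj (modelVec v)))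
      w := by
  have h := hf.contMDiffOn_tangentMapWithin (m := ∞) le_rfl hU.uniqueMDiffOn
  have hO : IsOpen (π E (TangentSpace I) ⁻¹' U : Set (TangentBundle I M)) :=
    hU.preimage (FiberBundle.continuous_proj E (TangentSpace I))
  refine (h.contMDiffAt (hO.mem_nhds hw)).congr_of_eventuallyEq ?_
  filter_upwards [hO.mem_nhds hw] with v hv
  have : mfderivWithin I I' f U v.proj = mfderiv I I' f v.proj :=
    mfderivWithin_of_isOpen hU hv
  simp only [tangentMapWithin, this]
  rfl

theorem contMDiffAt_tangentMk_prod [IsManifold I ∞ M] [IsManifold I' ∞ M'] {N : Type*}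
    {EN FN : Type*} [NormedAddCommGroup EN] [NormedSpace ℝ EN] [TopologicalSpace FN]
    {J : ModelWithCorners ℝ EN FN} [TopologicalSpace N] [ChartedSpace FN N]
    {f : N → M} {u : N → E} {g : N → M'} {v : N → E'} {a : N}
    (hf : ContMDiffAt J I.tangent ∞ (fun x => tangentMk I (f x) (u x)) a)
    (hg : ContMDiffAt J I'.tangent ∞ (fun x => tangentMk I' (g x) (v x)) a) :
    ContMDiffAt J (I.prod I').tangent ∞
      (fun x => tangentMk (I.prod I') (f x, g x) (u x, v x)) a :=
  (contMDiff_equivTangentBundleProd_symm (n := ∞) (I := I) (M := M) (I' := I') (M' := M')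
    _).comp a (hf.prodMk hg)

theorem contMDiff_tangentMk_zero [IsManifold I ∞ M] :
    ContMDiff I I.tangent ∞ (fun x : M => tangentMk I x (0 : E)) :=
  contMDiff_zeroSection ℝ (TangentSpace I : M → Type _)

theorem contMDiff_tangentBundle_proj [IsManifold I ∞ M] :
    ContMDiff I.tangent I ∞ (fun w : TangentBundle I M => w.proj) :=
  contMDiff_proj (TangentSpace I : M → Type _)

/-- A map to a fixed tangent space is smooth if and only if it is smooth as a map to the tangent
bundle. -/
theorem contMDiffAt_tangentMk_const_iff [IsManifold I ∞ M] {N : Type*}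
    {EN FN : Type*} [NormedAddCommGroup EN] [NormedSpace ℝ EN] [TopologicalSpace FN]
    {J : ModelWithCorners ℝ EN FN} [TopologicalSpace N] [ChartedSpace FN N]
    {x : M} {u : N → E} {a : N} :
    ContMDiffAt J I.tangent ∞ (fun y => tangentMk I x (u y)) a ↔
      ContMDiffAt J 𝓘(ℝ, E) ∞ u a := by
  rw [ModelWithCorners.tangent, contMDiffAt_totalSpace]
  -- The base point is constantly `x`, and over `x` the trivialization at `x` is the identity on the
  -- fibre.
  have : ∀ y, ((trivializationAt E (TangentSpace I) (tangentMk I x (u a)).proj)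
      (tangentMk I x (u y))).2 = u y := by
    intro y
    exact tangentCoordChange_self (I := I) (mem_extChartAt_source (I := I) x)
  simp only [this]
  exact ⟨fun h => h.2, fun h => ⟨contMDiffAt_const, h⟩⟩

end ModelDeriv

end HiggsGauge

namespace HiggsGauge

open Set Filter

/-! ### Submersions and immersions -/

section Submersion

variable {E E' E'' F F' F'' M M' M'' : Type*}
  [NormedAddCommGroup E] [NormedSpace ℝ E] [TopologicalSpace F] {I : ModelWithCorners ℝ E F}
  [TopologicalSpace M] [ChartedSpace F M]
  [NormedAddCommGroup E'] [NormedSpace ℝ E'] [TopologicalSpace F'] {I' : ModelWithCorners ℝ E' F'}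
  [TopologicalSpace M'] [ChartedSpace F' M']
  [NormedAddCommGroup E''] [NormedSpace ℝ E''] [TopologicalSpace F'']
  {I'' : ModelWithCorners ℝ E'' F''} [TopologicalSpace M''] [ChartedSpace F'' M'']

/-- Around a point `x`, a submersion `f` splits off a factor: `y ↦ (f y, β y)` is inverse to a
smooth map `Φ`. -/
theorem IsSubmersionAtOfComplement.exists_split {C : Type*} [NormedAddCommGroup C]
    [NormedSpace ℝ C] [I.Boundaryless] {f : M → M'} {x : M}
    (hf : IsSubmersionAtOfComplement C I I' ∞ f x) :
    ∃ (Φ : M' × C → M) (β : M → C) (U : Set M) (W : Set (M' × C)), IsOpen U ∧ x ∈ U ∧ IsOpen W ∧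
      (f x, β x) ∈ W ∧ ContMDiffOn (I'.prod 𝓘(ℝ, C)) I ∞ Φ W ∧ ContMDiffOn I 𝓘(ℝ, C) ∞ β U ∧
      (∀ y ∈ U, Φ (f y, β y) = y) ∧ ∀ z ∈ W, f (Φ z) = z.1 := by
  set φ := hf.domChart with hφ
  set ψ := hf.codChart with hψ
  set e := hf.equiv
  -- In the charts φ and ψ the map `f` is the first component of `e`. Inverting `e` and reading the
  -- first component through ψ gives the chart expression of Φ.
  set T : M' × C → E := fun z => e.symm (ψ.extend I' z.1, z.2) with hT
  have hTs : ContMDiffOn (I'.prod 𝓘(ℝ, C)) 𝓘(ℝ, E) ∞ T (ψ.source ×ˢ univ) := by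
    have h1 : ContMDiffOn (I'.prod 𝓘(ℝ, C)) 𝓘(ℝ, E' × C) ∞
        (fun z : M' × C => (ψ.extend I' z.1, z.2)) (ψ.source ×ˢ univ) :=
      ((ψ.contMDiffOn_extend hf.codChart_mem_maximalAtlas).comp contMDiffOn_fst
        (fun z hz => hz.1)).prodMk_space contMDiffOn_snd
    have h2 : ContMDiff 𝓘(ℝ, E' × C) 𝓘(ℝ, E) ∞ e.symm := e.symm.contDiff.contMDiff
    exact h2.comp_contMDiffOn h1
  have hopenψ : IsOpen (ψ.source ×ˢ (univ : Set C)) := ψ.open_source.prod isOpen_univ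
  have hopenT : IsOpen (φ.extend I).target := φ.isOpen_extend_target
  refine ⟨fun z => (φ.extend I).symm (T z), fun y => (e (φ.extend I y)).2, φ.source,
    (ψ.source ×ˢ univ) ∩ T ⁻¹' (φ.extend I).target, φ.open_source, hf.mem_domChart_source,
    hTs.continuousOn.isOpen_inter_preimage hopenψ hopenT, ?_, ?_, ?_, ?_, ?_⟩
  all_goals
    have key : ∀ y ∈ φ.source, T (f y, (e (φ.extend I y)).2) = φ.extend I y := by
      intro y hy
      have h1 := hf.writtenInCharts ((φ.extend I).map_source (by rwa [φ.extend_source]))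
      simp only [Function.comp_apply] at h1
      rw [φ.extend_left_inv hy] at h1
      simp only [hT]
      rw [h1]
      simp [e]
  · refine ⟨⟨hf.mem_codChart_source, mem_univ _⟩, ?_⟩
    rw [mem_preimage, key x hf.mem_domChart_source]
    exact (φ.extend I).map_source (by rw [φ.extend_source]; exact hf.mem_domChart_source)
  · have h3 : ContMDiffOn 𝓘(ℝ, E) I ∞ (φ.extend I).symm (φ.extend I).target := by
      have := contMDiffOn_extend_symm (I := I) hf.domChart_mem_maximalAtlas
      rwa [← φ.extend_target'] at this
    exact h3.comp (hTs.mono inter_subset_left) (fun z hz => hz.2)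
  · have h1 := φ.contMDiffOn_extend (I := I) hf.domChart_mem_maximalAtlas
    have h2 : ContMDiff 𝓘(ℝ, E) 𝓘(ℝ, C) ∞ (fun v : E => (e v).2) :=
      ((ContinuousLinearMap.snd ℝ E' C).comp (e : E →L[ℝ] E' × C)).contDiff.contMDiff
    exact h2.comp_contMDiffOn h1
  · intro y hy
    simp only
    rw [key y hy, φ.extend_left_inv hy]
  · rintro z ⟨⟨hz1, -⟩, hz2⟩
    have h1 := hf.writtenInCharts hz2
    simp only [Function.comp_apply] at h1
    have h2 : (e (T z)).1 = ψ.extend I' z.1 := by simp [hT]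
    change ψ.extend I' _ = (e (T z)).1 at h1
    rw [h2] at h1
    refine (ψ.extend I').injOn ?_ (by rwa [ψ.extend_source]) h1
    rw [ψ.extend_source]
    refine hf.source_subset_preimage_source ?_
    have := (φ.extend I).map_target hz2
    rwa [φ.extend_source] at this

/-- Freezing the complementary coordinate of the splitting at its value at `x` leaves a local
section through `x`. -/
theorem IsSubmersion.exists_section [I.Boundaryless] {f : M → M'} (hf : IsSubmersion I I' ∞ f)
    (x : M) : ∃ (s : M' → M) (U : Set M'), IsOpen U ∧ f x ∈ U ∧ s (f x) = x ∧
      ContMDiffOn I' I ∞ s U ∧ ∀ y ∈ U, f (s y) = y := by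
  obtain ⟨Φ, β, U, W, hU, hx, hW, hxW, hΦ, hβ, h1, h2⟩ :=
    IsSubmersionAtOfComplement.exists_split (hf.isSubmersionOfComplement_complement x)
  have hc : Continuous (fun y : M' => (y, β x)) := by fun_prop
  exact ⟨fun y => Φ (y, β x), (fun y => (y, β x)) ⁻¹' W, hW.preimage hc, hxW, h1 x hx,
    hΦ.comp (contMDiff_id.prodMk contMDiff_const).contMDiffOn (fun y hy => hy),
    fun y hy => h2 _ hy⟩

/-- A vector that is vertical for a submersion `f` is tangent to the fibre: it is fixed by the
derivative of a local retraction to the fibre. -/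
theorem IsSubmersion.exists_fibre_retraction [I.Boundaryless] {f : M → M'}
    (hf : IsSubmersion I I' ∞ f) (x : M) : ∃ ρ : M → M, ContMDiffAt I I ∞ ρ x ∧ ρ x = x ∧
      (∀ᶠ y in 𝓝 x, f (ρ y) = f x) ∧
      ∀ w : E, modelDeriv I I' f x w = 0 → modelDeriv I I ρ x w = w := by
  obtain ⟨Φ, β, U, W, hU, hx, hW, hxW, hΦ, hβ, h1, h2⟩ :=
    IsSubmersionAtOfComplement.exists_split (hf.isSubmersionOfComplement_complement x)
  have hΦx := hΦ.contMDiffAt (hW.mem_nhds hxW)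
  have hβx := hβ.contMDiffAt (hU.mem_nhds hx)
  have hfx := hf.contMDiff.contMDiffAt (x := x)
  -- Here the coordinate `f` is frozen instead. If `df w = 0`, differentiating `Φ (f y, β y) = y`
  -- gives `dΦ (0, dβ w) = w`, and the left side is also `dρ w`.
  refine ⟨fun y => Φ (f x, β y), hΦx.comp x (contMDiffAt_const.prodMk hβx), h1 x hx, ?_, ?_⟩
  · have hc : ContinuousAt (fun y => (f x, β y)) x := continuousAt_const.prodMk hβx.continuousAt
    filter_upwards [hc.preimage_mem_nhds (hW.mem_nhds hxW)] with y hy using h2 _ hy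
  · intro w hw
    have dΦ := hΦx.mdifferentiableAt (by simp)
    have dβ := hβx.mdifferentiableAt (by simp)
    have df := hfx.mdifferentiableAt (by simp)
    have e1 : modelDeriv I I (fun y => Φ (f y, β y)) x w = w := by
      rw [modelDeriv_congr (g := fun y => y) (by filter_upwards [hU.mem_nhds hx] using h1),
        modelDeriv_id]
      rfl
    rw [modelDeriv_comp_apply dΦ (df.prodMk dβ) rfl, modelDeriv_prodMk df dβ, hw] at e1
    rw [modelDeriv_comp_apply dΦ (mdifferentiableAt_const.prodMk dβ) rfl,
      modelDeriv_prodMk mdifferentiableAt_const dβ, modelDeriv_const]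
    exact e1

theorem IsSubmersion.modelDeriv_surjective [I.Boundaryless] {f : M → M'}
    (hf : IsSubmersion I I' ∞ f) (x : M) : Function.Surjective (modelDeriv I I' f x) := by
  obtain ⟨s, U, hU, hx, hsx, hs, h⟩ := IsSubmersion.exists_section hf x
  intro w
  refine ⟨modelDeriv I' I s (f x) w, ?_⟩
  rw [← modelDeriv_comp_apply (hf.contMDiff.mdifferentiableAt (by simp))
    ((hs.contMDiffAt (hU.mem_nhds hx)).mdifferentiableAt (by simp)) hsx,
    modelDeriv_congr (g := fun y => y) (by filter_upwards [hU.mem_nhds hx] using h), modelDeriv_id]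
  rfl

/-- Locally `g = (g ∘ f) ∘ s` for a section `s` of `f`. This gives the smoothness of maps out of
associated bundles. -/
theorem IsSubmersion.contMDiff_of_comp [I.Boundaryless] {f : M → M'}
    (hf : IsSubmersion I I' ∞ f) (hsurj : Function.Surjective f) {g : M' → M''}
    (hg : ContMDiff I I'' ∞ (fun x => g (f x))) : ContMDiff I' I'' ∞ g := by
  intro y
  obtain ⟨x, rfl⟩ := hsurj y
  obtain ⟨s, U, hU, hx, hsx, hs, h⟩ := IsSubmersion.exists_section hf x
  refine ((hg _).comp (f x) (hs.contMDiffAt (hU.mem_nhds hx))).congr_of_eventuallyEq ?_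
  filter_upwards [hU.mem_nhds hx] with y hy
  simp [h y hy]

/-- In adapted charts `f` is `v ↦ (v, 0)`, so the first component of the target chart provides a
smooth local left inverse. -/
theorem IsImmersionAtOfComplement.modelDeriv_injective {C : Type*} [NormedAddCommGroup C]
    [NormedSpace ℝ C] [I.Boundaryless] {f : M → M'} {x : M}
    (hf : IsImmersionAtOfComplement C I I' ∞ f x) : Function.Injective (modelDeriv I I' f x) := by
  set φ := hf.domChart with hφ
  set ψ := hf.codChart with hψ
  set e := hf.equiv
  have hx := hf.mem_domChart_source
  have hψx := (ψ.contMDiffAt_extend (I := I') hf.codChart_mem_maximalAtlas hf.mem_codChart_source)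
  have h3 : ContMDiffAt 𝓘(ℝ, E) I ∞ (φ.extend I).symm (φ.extend I x) := by
    have := contMDiffOn_extend_symm (I := I) hf.domChart_mem_maximalAtlas
    rw [← φ.extend_target'] at this
    exact this.contMDiffAt (φ.isOpen_extend_target.mem_nhds
      ((φ.extend I).map_source (by rwa [φ.extend_source])))
  have h4 : ContMDiff 𝓘(ℝ, E') 𝓘(ℝ, E) ∞ (fun v : E' => (e.symm v).1) :=
      ((ContinuousLinearMap.fst ℝ E C).comp (e.symm : E' →L[ℝ] E × C)).contDiff.contMDiff
  have h5 : ContMDiffAt I' 𝓘(ℝ, E) ∞ (fun y => (e.symm (ψ.extend I' y)).1) (f x) :=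
    h4.contMDiffAt.comp (f x) hψx
  have key : ∀ y ∈ φ.source, (e.symm (ψ.extend I' (f y))).1 = φ.extend I y := by
    intro y hy
    have h1 := hf.writtenInCharts ((φ.extend I).map_source (by rwa [φ.extend_source]))
    simp only [Function.comp_apply] at h1
    rw [φ.extend_left_inv hy] at h1
    rw [h1]
    simp [e]
  have h6 : ContMDiffAt I' I ∞ (fun y => (φ.extend I).symm (e.symm (ψ.extend I' y)).1) (f x) :=
    ContMDiffAt.comp (f x) (by rwa [key x hx]) h5
  have hfx := hf.contMDiffAt
  have h7 := modelDeriv_comp (h6.mdifferentiableAt (by simp)) (hfx.mdifferentiableAt (by simp)) rfl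
  rw [modelDeriv_congr (g := fun y => y), modelDeriv_id] at h7
  · intro u v huv
    have hu := congrArg (fun L => L u) h7
    have hv := congrArg (fun L => L v) h7
    simp only [ContinuousLinearMap.comp_apply, ContinuousLinearMap.id_apply] at hu hv
    rw [hu, hv, huv]
  · filter_upwards [φ.open_source.mem_nhds hx] with y hy
    rw [key y hy, φ.extend_left_inv hy]

theorem IsSmoothEmbedding.modelDeriv_injective [I.Boundaryless] {f : M → M'}
    (hf : IsSmoothEmbedding I I' ∞ f) (x : M) : Function.Injective (modelDeriv I I' f x) :=
  IsImmersionAtOfComplement.modelDeriv_injective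
    (hf.isImmersion.isImmersionOfComplement_complement x)

end Submersion

/-! ### The adjoint representation -/

section Adjoint

variable {EG G : Type*} [NormedAddCommGroup EG] [NormedSpace ℝ EG]
  [Group G] [TopologicalSpace G] [ChartedSpace EG G]

variable (EG) in
/-- The adjoint representation, as a map to the operators of the model space. -/
def adMap (g : G) : EG →L[ℝ] EG :=
  modelDeriv 𝓘(ℝ, EG) 𝓘(ℝ, EG) (fun x : G => g * x * g⁻¹) 1

theorem adMap_one : adMap EG (1 : G) = ContinuousLinearMap.id ℝ EG := by
  have : (fun x : G => 1 * x * 1⁻¹) = fun x => x := by ext; simp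
  rw [adMap, this, modelDeriv_id]

variable (EG) in
/-- The left invariant vector field of `η`, with values in the model space. -/
def leftField (η : EG) (g : G) : EG := modelDeriv 𝓘(ℝ, EG) 𝓘(ℝ, EG) (fun x : G => g * x) 1 η

variable (G) in
/-- The bracket of the Lie algebra of `G`, as an operation on the model space. -/
def modelBracket (ξ η : EG) : EG :=
  Bracket.bracket (L := GroupLieAlgebra 𝓘(ℝ, EG) G) (M := GroupLieAlgebra 𝓘(ℝ, EG) G) ξ η

variable [LieGroup 𝓘(ℝ, EG) ∞ G]

theorem contMDiff_conj (g : G) :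
    ContMDiff 𝓘(ℝ, EG) 𝓘(ℝ, EG) ∞ (fun x : G => g * x * g⁻¹) :=
  (contMDiff_const.mul contMDiff_id).mul contMDiff_const

theorem adMap_mul (g h : G) : adMap EG (g * h) = (adMap EG g).comp (adMap EG h) := by
  have : (fun x : G => g * h * x * (g * h)⁻¹) = fun x => g * (h * x * h⁻¹) * g⁻¹ := by
    ext; simp [mul_assoc]
  rw [adMap, this]
  exact modelDeriv_comp (f := fun x => h * x * h⁻¹) (g := fun x => g * x * g⁻¹)
    ((contMDiff_conj g).mdifferentiableAt (by simp))
    ((contMDiff_conj h).mdifferentiableAt (by simp)) (by simp)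

theorem adMap_inv_apply_adMap (g : G) (ξ : EG) : adMap EG g⁻¹ (adMap EG g ξ) = ξ := by
  have := adMap_mul (EG := EG) g⁻¹ g
  rw [inv_mul_cancel, adMap_one] at this
  exact (congrArg (fun L => L ξ) this).symm

/-- A derivative depends smoothly on the parameters of the map. Every conjugation fixes 1, so the
coordinate changes in `inTangentCoordinates` are the identity. -/
theorem contMDiff_adMap : ContMDiff 𝓘(ℝ, EG) 𝓘(ℝ, EG →L[ℝ] EG) ∞ (adMap EG : G → _) := by
  intro g₀
  have h : ContMDiffAt (𝓘(ℝ, EG).prod 𝓘(ℝ, EG)) 𝓘(ℝ, EG) ∞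
      (Function.uncurry fun g x : G => g * x * g⁻¹) (g₀, 1) :=
    ((contMDiff_fst.mul contMDiff_snd).mul contMDiff_fst.inv).contMDiffAt
  have := ContMDiffAt.mfderiv (m := ∞) (fun g x : G => g * x * g⁻¹) (fun _ => (1 : G)) h
    contMDiffAt_const le_rfl
  refine this.congr_of_eventuallyEq (Eventually.of_forall fun g => ?_)
  have e0 := inTangentCoordinates_eq (I := 𝓘(ℝ, EG)) (I' := 𝓘(ℝ, EG)) (fun _ : G => (1 : G))
    (fun x : G => x * 1 * x⁻¹) (adMap EG) (x₀ := g₀) (x := g) (by simp) (by simp)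
  refine Eq.trans ?_ e0.symm
  ext ξ
  have e1 : ∀ v : EG, (tangentBundleCore 𝓘(ℝ, EG) G).coordChange (achart EG (1 : G))
      (achart EG (1 : G)) 1 v = v := fun v =>
    tangentCoordChange_self (I := 𝓘(ℝ, EG)) (mem_extChartAt_source (1 : G))
  simp only [mul_one, mul_inv_cancel, ContinuousLinearMap.comp_apply, e1]

/-- Since g x = (g x g⁻¹) g, left translation is conjugation followed by right translation.
Differentiating this identity in g at 1 relates Ad to the bracket. -/
theorem leftField_eq_right (g : G) (η : EG) :
    leftField EG η g =
      modelDeriv 𝓘(ℝ, EG) 𝓘(ℝ, EG) (fun x : G => x * g) 1 (adMap EG g η) := by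
  rw [adMap, ← modelDeriv_comp_apply (g := fun x => x * g) (f := fun x => g * x * g⁻¹)
    (contMDiff_mul_right.mdifferentiableAt (n := ∞) (by simp))
    ((contMDiff_conj g).mdifferentiableAt (by simp)) (by simp)]
  simp only [inv_mul_cancel_right]
  rfl

/-- The derivative of the adjoint representation at the identity is the Lie bracket. -/
theorem modelDeriv_adMap_one (ξ η : EG) :
    modelDeriv 𝓘(ℝ, EG) 𝓘(ℝ, EG →L[ℝ] EG) (adMap EG : G → _) 1 ξ η = modelBracket G ξ η := by
  set φ := extChartAt 𝓘(ℝ, EG) (1 : G) with hφ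
  set e : EG := φ 1 with he
  have hes : φ.symm e = 1 := extChartAt_to_inv (1 : G)
  -- Multiplication in the chart at 1. Invariant fields are partial derivatives of `f` along the
  -- axes through `e`, so the bracket is expressed by the second derivative of `f` at `(e, e)`.
  set f : EG × EG → EG := fun z => φ (φ.symm z.1 * φ.symm z.2) with hf
  have hte : φ.target ∈ 𝓝 e := extChartAt_target_mem_nhds (1 : G)
  have hsymm : ∀ a ∈ φ.target, ContMDiffAt 𝓘(ℝ, EG) 𝓘(ℝ, EG) ∞ φ.symm a := fun a ha =>
    (contMDiffOn_extChartAt_symm (1 : G)).contMDiffAt ((isOpen_extChartAt_target (1 : G)).mem_nhds ha)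
  have hchart : ∀ g ∈ φ.source, ContMDiffAt 𝓘(ℝ, EG) 𝓘(ℝ, EG) ∞ φ g := fun g hg =>
    contMDiffAt_extChartAt' (by rwa [← extChartAt_source 𝓘(ℝ, EG)])
  have hmem : (1 : G) ∈ φ.source := mem_extChartAt_source (1 : G)
  have hfe : ContDiffAt ℝ ∞ f (e, e) := by
    rw [← contMDiffAt_iff_contDiffAt]
    have h1 : ContMDiffAt 𝓘(ℝ, EG × EG) 𝓘(ℝ, EG) ∞ (fun z : EG × EG => φ.symm z.1 * φ.symm z.2)
        (e, e) :=
      ((hsymm e (mem_of_mem_nhds hte)).comp (e, e) contDiff_fst.contMDiff.contMDiffAt).mul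
        ((hsymm e (mem_of_mem_nhds hte)).comp (e, e) contDiff_snd.contMDiff.contMDiffAt)
    exact ContMDiffAt.comp (e, e) (hchart _ (by simpa [hes] using hmem)) h1
  have hfd : ∀ᶠ z in 𝓝 (e, e), DifferentiableAt ℝ f z := by
    filter_upwards [(hfe.of_le (m := 2) (WithTop.coe_le_coe.2 le_top)).eventually (by simp)] with z hz
      using hz.differentiableAt (by simp)
  have hself : ∀ ζ : EG, modelDeriv 𝓘(ℝ, EG) 𝓘(ℝ, EG) φ.symm e ζ = ζ := by
    intro ζ
    have := mfderivWithin_range_extChartAt_symm (I := 𝓘(ℝ, EG)) (x := (1 : G))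
    rw [ModelWithCorners.range_eq_univ, mfderivWithin_univ] at this
    exact congrArg (fun L : EG →L[ℝ] EG => L ζ) this
  have hL : ∀ᶠ a in 𝓝 e, ∀ η : EG, fderiv ℝ f (a, e) (0, η) = modelDeriv 𝓘(ℝ, EG) 𝓘(ℝ, EG) φ
      (φ.symm a) (leftField EG η (φ.symm a)) := by
    have hc : ContinuousAt (fun a : EG => (a, e)) e := by fun_prop
    filter_upwards [hte, hc.eventually hfd] with a ha hda η
    have h1 : fderiv ℝ f (a, e) (0, η) = fderiv ℝ (fun b => f (a, b)) e η := by
      have := (hda.hasFDerivAt.comp e (hasFDerivAt_prodMk_right a e)).fderiv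
      change fderiv ℝ (fun b => f (a, b)) e = _ at this
      rw [this]; simp
    have h2 : fderiv ℝ (fun b => f (a, b)) e η =
        modelDeriv 𝓘(ℝ, EG) 𝓘(ℝ, EG) (fun b => φ (φ.symm a * φ.symm b)) e η := by
      rw [modelDeriv, mfderiv_eq_fderiv]
    have d1 := (hsymm e (mem_of_mem_nhds hte)).mdifferentiableAt (by simp)
    have d2 : MDifferentiableAt 𝓘(ℝ, EG) 𝓘(ℝ, EG) (fun x : G => φ.symm a * x) 1 :=
      contMDiff_mul_left.mdifferentiableAt (n := ∞) (by simp)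
    have d3 := (hchart (φ.symm a) (φ.map_target ha)).mdifferentiableAt (by simp)
    rw [h1, h2, modelDeriv_comp_apply (f := fun b => φ.symm a * φ.symm b) d3
      (d2.comp_of_eq e d1 hes) (by simp [hes]), modelDeriv_comp_apply d2 d1 hes, hself, leftField]
  have hR : ∀ᶠ a in 𝓝 e, ∀ ζ : EG, fderiv ℝ f (e, a) (ζ, 0) = modelDeriv 𝓘(ℝ, EG) 𝓘(ℝ, EG) φ
      (φ.symm a) (modelDeriv 𝓘(ℝ, EG) 𝓘(ℝ, EG) (fun x : G => x * φ.symm a) 1 ζ) := by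
    have hc : ContinuousAt (fun a : EG => (e, a)) e := by fun_prop
    filter_upwards [hte, hc.eventually hfd] with a ha hda ζ
    have h1 : fderiv ℝ f (e, a) (ζ, 0) = fderiv ℝ (fun b => f (b, a)) e ζ := by
      have := (hda.hasFDerivAt.comp e (f := fun b => (b, a)) (hasFDerivAt_prodMk_left e a)).fderiv
      change fderiv ℝ (fun b => f (b, a)) e = _ at this
      rw [this]; simp
    have h2 : fderiv ℝ (fun b => f (b, a)) e ζ =
        modelDeriv 𝓘(ℝ, EG) 𝓘(ℝ, EG) (fun b => φ (φ.symm b * φ.symm a)) e ζ := by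
      rw [modelDeriv, mfderiv_eq_fderiv]
    have d1 := (hsymm e (mem_of_mem_nhds hte)).mdifferentiableAt (by simp)
    have d2 : MDifferentiableAt 𝓘(ℝ, EG) 𝓘(ℝ, EG) (fun x : G => x * φ.symm a) 1 :=
      contMDiff_mul_right.mdifferentiableAt (n := ∞) (by simp)
    have d3 := (hchart (φ.symm a) (φ.map_target ha)).mdifferentiableAt (by simp)
    rw [h1, h2, modelDeriv_comp_apply (f := fun b => φ.symm b * φ.symm a) d3
      (d2.comp_of_eq e d1 hes) (by simp [hes]), modelDeriv_comp_apply (g := fun x => x * φ.symm a) d2 d1 hes, hself]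
  set D2 := fderiv ℝ (fderiv ℝ f) (e, e) with hD2
  have hD2d : HasFDerivAt (fderiv ℝ f) D2 (e, e) :=
    ((hfe.fderiv_right (m := ∞) le_rfl).differentiableAt (by simp)).hasFDerivAt
  have hsym : ∀ u v, D2 u v = D2 v u := hfe.isSymmSndFDerivAt (by simp only [minSmoothness_of_isRCLikeNormedField]; exact WithTop.coe_le_coe.2 le_top)
  -- the left invariant fields in the chart
  have hLd : ∀ η : EG, HasFDerivAt (fun a => fderiv ℝ f (a, e) (0, η))
      ((D2.comp (ContinuousLinearMap.inl ℝ EG EG)).flip (0, η)) e := by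
    intro η
    have := (hD2d.comp e (f := fun b => (b, e)) (hasFDerivAt_prodMk_left e e)).clm_apply (hasFDerivAt_const (0, η) e)
    simpa using this
  -- The Lie algebra bracket is computed by pulling the invariant fields back to the chart. Near `e`
  -- they are the partial derivatives found above, and the chart has the identity as derivative at
  -- 1, so the value needs no correction.
  obtain ⟨V, hV, hVbr⟩ : ∃ V : EG → EG → EG,
      (∀ ζ, V ζ =ᶠ[𝓝 e] fun a => fderiv ℝ f (a, e) (0, ζ)) ∧
      modelBracket G ξ η = VectorField.lieBracket ℝ (V ξ) (V η) e := by
    refine ⟨fun ζ a => VectorField.mpullbackWithin 𝓘(ℝ, EG) 𝓘(ℝ, EG) φ.symm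
      (mulInvariantVectorField (I := 𝓘(ℝ, EG)) (G := G) ζ) (range 𝓘(ℝ, EG)) a, ?_, ?_⟩
    · intro ζ
      filter_upwards [hte, hL] with a ha hLa
      have hinv := isInvertible_mfderivWithin_extChartAt_symm (I := 𝓘(ℝ, EG)) ha
      have h1 := mfderivWithin_extChartAt_symm_comp_mfderiv_extChartAt (I := 𝓘(ℝ, EG)) ha
      have h2 : ∀ v : EG, (mfderivWithin 𝓘(ℝ, EG) 𝓘(ℝ, EG) φ.symm (range 𝓘(ℝ, EG)) a)
          (modelDeriv 𝓘(ℝ, EG) 𝓘(ℝ, EG) φ (φ.symm a) v) = v :=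
        fun v => congrArg (fun L : EG →L[ℝ] EG => L v) h1
      rw [hLa, VectorField.mpullbackWithin_apply]
      refine Eq.trans ?_ (hinv.inverse_apply_self _)
      exact congrArg _ (h2 _).symm
    · have h1 : modelDeriv 𝓘(ℝ, EG) 𝓘(ℝ, EG) φ 1 = ContinuousLinearMap.id ℝ EG :=
        mfderiv_extChartAt_self (I := 𝓘(ℝ, EG)) (x := (1 : G))
      have hid : ∀ v : EG, (modelDeriv 𝓘(ℝ, EG) 𝓘(ℝ, EG) φ 1).inverse v = v := by
        intro v
        rw [h1, ContinuousLinearMap.inverse_id]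
        rfl
      have huniv : ∀ (W W' : EG → EG) (s : Set EG), s = univ → ∀ a,
          VectorField.lieBracketWithin ℝ W W' s a = VectorField.lieBracket ℝ W W' a := by
        rintro W W' s rfl a
        rw [VectorField.lieBracketWithin_univ]
      exact (VectorField.mlieBracketWithin_apply (I := 𝓘(ℝ, EG)) (M := G)).trans
        ((hid _).trans (huniv _ _ _ (by simp) _))
  have hself' : ∀ ζ : EG, modelDeriv 𝓘(ℝ, EG) 𝓘(ℝ, EG) φ 1 ζ = ζ := fun ζ =>
    congrArg (fun L : EG →L[ℝ] EG => L ζ)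
      (mfderiv_extChartAt_self (I := 𝓘(ℝ, EG)) (x := (1 : G)))
  have hLe : ∀ η : EG, fderiv ℝ f (e, e) (0, η) = η := by
    intro η
    rw [hL.self_of_nhds η, hes, hself', leftField_eq_right, adMap_one]
    simp only [mul_one, modelDeriv_id]
    rfl
  have hRe : ∀ ζ : EG, fderiv ℝ f (e, e) (ζ, 0) = ζ := by
    intro ζ
    rw [hR.self_of_nhds ζ, hes, hself']
    simp only [mul_one, modelDeriv_id]
    rfl
  have hbr : modelBracket G ξ η = D2 (ξ, 0) (0, η) - D2 (η, 0) (0, ξ) := by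
    rw [hVbr, VectorField.lieBracket, (hV ξ).fderiv_eq, (hV η).fderiv_eq, (hLd ξ).fderiv,
      (hLd η).fderiv, (hV ξ).self_of_nhds, (hV η).self_of_nhds]
    simp only [hLe]
    rfl
  have hÂ : HasFDerivAt (fun a => adMap EG (φ.symm a))
      (modelDeriv 𝓘(ℝ, EG) 𝓘(ℝ, EG →L[ℝ] EG) (adMap EG : G → _) 1) e := by
    have := (contMDiff_adMap (EG := EG) (G := G)).mdifferentiableAt (by simp) (x := 1)
    have h2 := this.hasMFDerivAt.2
    rw [ModelWithCorners.range_eq_univ] at h2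
    exact hasFDerivWithinAt_univ.1 h2
  -- Both sides are the left invariant field of `η` in the chart. Their derivatives along `ξ` are
  -- `D2 (ξ, 0) (0, η)` and `D2 (0, ξ) (η, 0) + dAd ξ η`; by symmetry of `D2`, `hbr` identifies `dAd
  -- ξ η` with the bracket.
  have hEq : (fun a => fderiv ℝ f (a, e) (0, η)) =ᶠ[𝓝 e]
      fun a => fderiv ℝ f (e, a) (adMap EG (φ.symm a) η, 0) := by
    filter_upwards [hL, hR] with a h1 h2
    rw [h1, h2, leftField_eq_right]
  have hd := (hD2d.comp e (f := fun b => (e, b)) (hasFDerivAt_prodMk_right e e)).clm_apply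
    ((hÂ.clm_apply (hasFDerivAt_const η e)).prodMk (hasFDerivAt_const (0 : EG) e))
  have hfin := congrArg (fun L => L ξ) ((hd.congr_of_eventuallyEq hEq).unique (hLd η))
  simp only [hes, adMap_one, Function.comp_apply, add_apply, ContinuousLinearMap.comp_apply,
    ContinuousLinearMap.flip_apply, ContinuousLinearMap.prod_apply, zero_apply,
    ContinuousLinearMap.inr_apply, ContinuousLinearMap.inl_apply, map_zero, zero_add,
    ContinuousLinearMap.id_apply, hRe] at hfin
  rw [hbr, ← hfin, hsym (η, 0)]
  abel

end Adjoint

/-! ### Invariance of a complement of the Lie algebra of a subgroup -/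

/-- A differentiable map on a ball whose derivative is bounded by a multiple of its value vanishes
if it vanishes at the centre. -/
theorem eqOn_zero_of_norm_fderiv_le {E F : Type*} [NormedAddCommGroup E] [NormedSpace ℝ E]
    [NormedAddCommGroup F] [NormedSpace ℝ F] {f : E → F} {a : E} {r C : ℝ}
    (hd : ∀ x ∈ Metric.ball a r, DifferentiableAt ℝ f x) (ha : f a = 0)
    (hb : ∀ x ∈ Metric.ball a r, ∀ u, ‖fderiv ℝ f x u‖ ≤ C * ‖u‖ * ‖f x‖) :
    ∀ x ∈ Metric.ball a r, f x = 0 := by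
  intro x hx
  have hmem : ∀ t ∈ Icc (0 : ℝ) 1, a + t • (x - a) ∈ Metric.ball a r := by
    intro t ht
    rw [Metric.mem_ball, dist_eq_norm] at hx ⊢
    rw [add_sub_cancel_left, norm_smul, Real.norm_of_nonneg ht.1]
    exact (mul_le_of_le_one_left (norm_nonneg _) ht.2).trans_lt hx
  have hder : ∀ t ∈ Icc (0 : ℝ) 1, HasDerivAt (fun t : ℝ => f (a + t • (x - a)))
      (fderiv ℝ f (a + t • (x - a)) (x - a)) t := by
    intro t ht
    have h1 : HasDerivAt (fun t : ℝ => a + t • (x - a)) (x - a) t := by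
      simpa using ((hasDerivAt_id t).smul_const (x - a)).const_add a
    exact (hd _ (hmem t ht)).hasFDerivAt.comp_hasDerivAt t h1
  -- Grönwall's inequality along the segment from `a` to `x`.
  have := eq_zero_of_abs_deriv_le_mul_abs_self_of_eq_zero_right
    (f := fun t : ℝ => f (a + t • (x - a))) (K := C * ‖x - a‖) (a := 0) (b := 1)
    (fun t ht => (hder t ht).continuousAt.continuousWithinAt)
    (fun t ht => (hder t (Ico_subset_Icc_self ht)).hasDerivWithinAt) (by simpa using ha)
    (fun t ht => hb _ (hmem t (Ico_subset_Icc_self ht)) _) 1 (by simp)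
  simpa using this

/-- A map that vanishes at a point vanishes near it if its derivative is bounded by its value times
a continuous function. -/
theorem eventually_eq_zero_of_norm_fderiv_le {E F A B : Type*} [NormedAddCommGroup E]
    [NormedSpace ℝ E] [NormedAddCommGroup F] [NormedSpace ℝ F] [NormedAddCommGroup A]
    [NormedSpace ℝ A] [NormedAddCommGroup B] {f : E → F} {a : E} {D : E → E →L[ℝ] A} {b : E → B}
    {c : ℝ} (hc : 0 ≤ c) (hd : ∀ᶠ x in 𝓝 a, DifferentiableAt ℝ f x) (ha : f a = 0)
    (hD : ContinuousAt D a) (hb : ContinuousAt b a)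
    (hbound : ∀ᶠ x in 𝓝 a, ∀ u, ‖fderiv ℝ f x u‖ ≤ ‖f x‖ * (‖b x‖ * (‖D x u‖ * c))) :
    ∀ᶠ x in 𝓝 a, f x = 0 := by
  have hcont : ContinuousAt (fun x => ‖b x‖ * ‖D x‖ * c) a :=
    (hb.norm.mul hD.norm).mul continuousAt_const
  have hlt : ∀ᶠ x in 𝓝 a, ‖b x‖ * ‖D x‖ * c < ‖b a‖ * ‖D a‖ * c + 1 :=
    hcont.eventually (gt_mem_nhds (lt_add_one _))
  obtain ⟨r, hr, hball⟩ := Metric.eventually_nhds_iff_ball.1 (hlt.and (hd.and hbound))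
  have hzero := eqOn_zero_of_norm_fderiv_le (f := f) (a := a) (r := r)
    (C := ‖b a‖ * ‖D a‖ * c + 1) (fun x hx => (hball x hx).2.1) ha (by
      intro x hx u
      have h1 := (hball x hx).1.le
      calc _ ≤ ‖f x‖ * (‖b x‖ * (‖D x u‖ * c)) := (hball x hx).2.2 u
        _ ≤ ‖f x‖ * (‖b x‖ * (‖D x‖ * ‖u‖ * c)) := by
            gcongr
            exact (D x).le_opNorm u
        _ = (‖b x‖ * ‖D x‖ * c) * ‖u‖ * ‖f x‖ := by ring
        _ ≤ _ := by gcongr)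
  filter_upwards [Metric.ball_mem_nhds a hr] using hzero

section Invariance

variable {EG EH G : Type*} [NormedAddCommGroup EG] [NormedSpace ℝ EG] [FiniteDimensional ℝ EG]
  [NormedAddCommGroup EH] [NormedSpace ℝ EH]
  [Group G] [TopologicalSpace G] [ChartedSpace EG G] [LieGroup 𝓘(ℝ, EG) ∞ G]
  {H : Subgroup G} [ChartedSpace EH H] [LieGroup 𝓘(ℝ, EH) ∞ H]

omit [FiniteDimensional ℝ EG] in
/-- The logarithmic derivative of the adjoint representation of a Lie subgroup is the bracket with
an element of its Lie algebra. -/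
theorem exists_modelDeriv_adMap_eq (hH : ContMDiff 𝓘(ℝ, EH) 𝓘(ℝ, EG) ∞ (Subtype.val : H → G))
    (k : H) (u : EH) :
    ∃ ξ : EH, ∀ η : EG,
      modelDeriv 𝓘(ℝ, EH) 𝓘(ℝ, EG →L[ℝ] EG) (fun l : H => adMap EG (l : G)) k u η =
        adMap EG (k : G) (modelBracket G (modelDeriv 𝓘(ℝ, EH) 𝓘(ℝ, EG) (Subtype.val : H → G) 1 ξ) η) := by
  -- The witness is `u` translated to the identity, because Ad(l) = Ad(k) Ad(k⁻¹ l).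
  refine ⟨modelDeriv 𝓘(ℝ, EH) 𝓘(ℝ, EH) (fun l : H => k⁻¹ * l) k u, fun η => ?_⟩
  have hval := hH.mdifferentiableAt (x := (1 : H)) (by simp)
  have hAd := (contMDiff_adMap (EG := EG) (G := G)).mdifferentiableAt (x := 1) (by simp)
  have hl : MDifferentiableAt 𝓘(ℝ, EH) 𝓘(ℝ, EH) (fun l : H => k⁻¹ * l) k :=
    contMDiff_mul_left.mdifferentiableAt (n := ∞) (by simp)
  have hcomp : MDifferentiableAt 𝓘(ℝ, EH) 𝓘(ℝ, EG →L[ℝ] EG) (fun l : H => adMap EG (l : G)) 1 :=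
    hAd.comp_of_eq 1 hval rfl
  have hcl : MDifferentiableAt 𝓘(ℝ, EG →L[ℝ] EG) 𝓘(ℝ, EG →L[ℝ] EG)
      (fun L => (adMap EG (k : G)).comp L) (adMap EG (1 : G)) :=
    ((ContinuousLinearMap.compL ℝ EG EG EG (adMap EG (k : G))).differentiableAt).mdifferentiableAt
  have hfac : (fun l : H => adMap EG (l : G)) =
      fun l => (adMap EG (k : G)).comp (adMap EG ((k⁻¹ * l : H) : G)) := by
    ext l : 1
    rw [← adMap_mul]
    simp
  have h1 : modelDeriv 𝓘(ℝ, EG →L[ℝ] EG) 𝓘(ℝ, EG →L[ℝ] EG)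
      (fun L => (adMap EG (k : G)).comp L) (adMap EG (1 : G)) =
      ContinuousLinearMap.compL ℝ EG EG EG (adMap EG (k : G)) :=
    mfderiv_eq_fderiv.trans (ContinuousLinearMap.compL ℝ EG EG EG (adMap EG (k : G))).fderiv
  rw [hfac, modelDeriv_comp_apply (g := fun L => (adMap EG (k : G)).comp L)
    (f := fun l : H => adMap EG ((k⁻¹ * l : H) : G)) hcl
    (hcomp.comp_of_eq k hl (by simp)) (by simp),
    modelDeriv_comp_apply (g := fun l : H => adMap EG (l : G)) hcomp hl (by simp),
    modelDeriv_comp_apply (g := adMap EG) hAd hval rfl, h1, ← modelDeriv_adMap_one]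
  rfl

/-- With q a projection onto 𝔣 and p = 1 − q, the element k preserves 𝔣 exactly when F(k) = p Ad(k)
q vanishes. The derivative of F is p Ad(k) ad(ξ) q = F(k) ad(ξ) q, as ad(ξ) maps 𝔣 into itself.
Hence F vanishes near each of its zeros, its zero set is clopen, and one zero in each component
suffices. -/
theorem adMap_mem_of_bracket_mem
    (hH : ContMDiff 𝓘(ℝ, EH) 𝓘(ℝ, EG) ∞ (Subtype.val : H → G)) (𝔣 : Submodule ℝ EG)
    (hbr : ∀ ξ : EH, ∀ η ∈ 𝔣,
      modelBracket G (modelDeriv 𝓘(ℝ, EH) 𝓘(ℝ, EG) (Subtype.val : H → G) 1 ξ) η ∈ 𝔣)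
    (hcomp : ∀ k : H, ∃ k' ∈ connectedComponent k, ∀ η ∈ 𝔣, adMap EG (k' : G) η ∈ 𝔣)
    (k : H) {η : EG} (hη : η ∈ 𝔣) : adMap EG (k : G) η ∈ 𝔣 := by
  obtain ⟨𝔥, h𝔥⟩ := 𝔣.exists_isCompl
  -- `q` is a projection with range `𝔣`, so that `k` preserves `𝔣` when `F k` vanishes
  obtain ⟨q, hq1, hq2⟩ : ∃ q : EG →L[ℝ] EG, (∀ v, q v ∈ 𝔣) ∧ ∀ v ∈ 𝔣, q v = v := by
    refine ⟨LinearMap.toContinuousLinearMap (𝔣.subtype ∘ₗ 𝔣.projectionOnto 𝔥 h𝔥), ?_, ?_⟩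
    · intro v; simp
    · intro v hv
      simpa using congrArg Subtype.val (Submodule.projectionOnto_apply_left h𝔥 ⟨v, hv⟩)
  set p : EG →L[ℝ] EG := ContinuousLinearMap.id ℝ EG - q with hp
  have hp0 : ∀ v, p v = 0 ↔ v ∈ 𝔣 := fun v =>
    ⟨fun h => by
      have : v = q v := sub_eq_zero.1 h
      rw [this]; exact hq1 v, fun h => by simp [hp, hq2 v h]⟩
  set F : H → EG →L[ℝ] EG := fun k => p.comp ((adMap EG (k : G)).comp q) with hF
  have hF0 : ∀ k : H, F k = 0 ↔ ∀ η ∈ 𝔣, adMap EG (k : G) η ∈ 𝔣 := by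
    intro k
    constructor
    · intro h η hη
      have := congrArg (fun L => L η) h
      simpa [hF, hp0, hq2 η hη] using this
    · intro h
      ext v
      exact (hp0 _).2 (h _ (hq1 v))
  have hAds : ContMDiff 𝓘(ℝ, EH) 𝓘(ℝ, EG →L[ℝ] EG) ∞ (fun l : H => adMap EG (l : G)) :=
    contMDiff_adMap.comp hH
  have hFc : Continuous F := by
    have := hAds.continuous
    fun_prop
  have hopen : IsOpen {k : H | F k = 0} := by
    rw [isOpen_iff_mem_nhds]
    intro k₀ hk₀
    set φ := extChartAt 𝓘(ℝ, EH) k₀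
    have hts : ContMDiffOn 𝓘(ℝ, EH) 𝓘(ℝ, EH) ∞ φ.symm φ.target := contMDiffOn_extChartAt_symm k₀
    have hto : IsOpen φ.target := isOpen_extChartAt_target k₀
    set a : EH → EG →L[ℝ] EG := fun x => adMap EG ((φ.symm x : H) : G) with ha
    have has : ContDiffOn ℝ ∞ a φ.target := contMDiffOn_iff_contDiffOn.1 (hAds.comp_contMDiffOn hts)
    set b : EH → EG →L[ℝ] EG := fun x => adMap EG ((φ.symm x : H) : G)⁻¹ with hb
    have hbs : ContinuousOn b φ.target := by
      have h1 : Continuous (fun l : H => adMap EG (l : G)⁻¹) := by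
        have := hAds.continuous.comp (contMDiff_inv 𝓘(ℝ, EH) ∞ (G := H)).continuous
        exact this
      exact h1.comp_continuousOn hts.continuousOn
    have hda : ContinuousOn (fderiv ℝ a) φ.target := has.continuousOn_fderiv_of_isOpen hto (by simp)
    have hae : φ k₀ ∈ φ.target := mem_extChartAt_target k₀
    have hdiff : ∀ x ∈ φ.target, DifferentiableAt ℝ a x := fun x hx =>
      (has.contDiffAt (hto.mem_nhds hx)).differentiableAt (by simp)
    have hfd : ∀ x ∈ φ.target, HasFDerivAt (fun x => F (φ.symm x))
        (((ContinuousLinearMap.compL ℝ EG EG EG p).comp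
          ((ContinuousLinearMap.compL ℝ EG EG EG).flip q)).comp (fderiv ℝ a x)) x := fun x hx =>
      ((ContinuousLinearMap.compL ℝ EG EG EG p).comp
          ((ContinuousLinearMap.compL ℝ EG EG EG).flip q)).hasFDerivAt.comp x
        (hdiff x hx).hasFDerivAt
    -- The product `b x ∘ da u` is ad(ξ) for the logarithmic derivative ξ. Writing it with `b` and
    -- `fderiv ℝ a` keeps the coefficients continuous in `x`, as the norm estimate requires.
    have hmain : ∀ x ∈ φ.target, ∀ u, fderiv ℝ (fun x => F (φ.symm x)) x u =
        (F (φ.symm x)).comp ((b x).comp ((fderiv ℝ a x u).comp q)) := by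
      intro x hx u
      rw [(hfd x hx).fderiv]
      ext v
      have hu : fderiv ℝ a x u = modelDeriv 𝓘(ℝ, EH) 𝓘(ℝ, EG →L[ℝ] EG)
          (fun l : H => adMap EG (l : G)) (φ.symm x)
            (modelDeriv 𝓘(ℝ, EH) 𝓘(ℝ, EH) φ.symm x u) := by
        rw [← modelDeriv_comp_apply (g := fun l : H => adMap EG (l : G))
          (hAds.mdifferentiableAt (by simp))
          ((hts.contMDiffAt (hto.mem_nhds hx)).mdifferentiableAt (by simp)) rfl, modelDeriv,
          mfderiv_eq_fderiv]
      obtain ⟨ξ, hξ⟩ := exists_modelDeriv_adMap_eq (EG := EG) hH (φ.symm x)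
        (modelDeriv 𝓘(ℝ, EH) 𝓘(ℝ, EH) φ.symm x u)
      have hmem := hbr ξ (q v) (hq1 v)
      simp only [ContinuousLinearMap.comp_apply, ContinuousLinearMap.compL_apply,
        ContinuousLinearMap.flip_apply, hF, hb, hu, hξ, adMap_inv_apply_adMap, hq2 _ hmem]
    have hzero : ∀ᶠ x in 𝓝 (φ k₀), F (φ.symm x) = 0 := by
      refine eventually_eq_zero_of_norm_fderiv_le (f := fun x => F (φ.symm x)) (D := fderiv ℝ a)
        (b := b) (norm_nonneg q) ?_ (by simpa [φ, extChartAt_to_inv] using hk₀)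
        (hda.continuousAt (hto.mem_nhds hae)) (hbs.continuousAt (hto.mem_nhds hae)) ?_
      · filter_upwards [hto.mem_nhds hae] with x hx using (hfd x hx).differentiableAt
      · filter_upwards [hto.mem_nhds hae] with x hx u
        rw [hmain x hx u]
        refine (ContinuousLinearMap.opNorm_comp_le _ _).trans ?_
        gcongr
        refine (ContinuousLinearMap.opNorm_comp_le _ _).trans ?_
        gcongr
        exact ContinuousLinearMap.opNorm_comp_le _ _
    have hcφ : ContinuousAt φ k₀ := continuousAt_extChartAt k₀
    filter_upwards [hcφ.eventually hzero,
      extChartAt_source_mem_nhds (I := 𝓘(ℝ, EH)) k₀] with l hl hls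
    rwa [φ.left_inv hls] at hl
  have hclopen : IsClopen {k : H | F k = 0} := ⟨isClosed_eq hFc continuous_const, hopen⟩
  obtain ⟨k', hk', hk'f⟩ := hcomp k
  have hsub := hclopen.connectedComponent_subset ((hF0 k').2 hk'f)
  rw [← connectedComponent_eq hk'] at hsub
  exact (hF0 k).1 (hsub mem_connectedComponent) η hη

end Invariance

/-! ### Fundamental vectors and the connection form -/

section Action

variable {EK EQ K Q : Type*}
  [NormedAddCommGroup EK] [NormedSpace ℝ EK] [NormedAddCommGroup EQ] [NormedSpace ℝ EQ]
  [Group K] [TopologicalSpace K] [ChartedSpace EK K]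
  [TopologicalSpace Q] [ChartedSpace EQ Q] [MulAction Kᵐᵒᵖ Q]

omit [TopologicalSpace K] [TopologicalSpace Q] in
theorem act_mul (q : Q) (k l : K) : q <• (k * l) = q <• k <• l := by
  simp [mul_smul]

omit [TopologicalSpace K] [TopologicalSpace Q] in
theorem act_inv_eq {q q' : Q} {k : K} (h : q <• k = q') : q' <• k⁻¹ = q := by
  rw [← h, ← act_mul, mul_inv_cancel]
  simp

variable (EK EQ K) in
/-- The fundamental vectors at a point, as an operator between the model spaces. -/
def modelFund (q : Q) : EK →L[ℝ] EQ := modelDeriv 𝓘(ℝ, EK) 𝓘(ℝ, EQ) (fun k : K => q <• k) 1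

theorem contMDiff_act_right
    (hact : ContMDiff (𝓘(ℝ, EQ).prod 𝓘(ℝ, EK)) 𝓘(ℝ, EQ) ∞ (fun z : Q × K => z.1 <• z.2)) (q : Q) :
    ContMDiff 𝓘(ℝ, EK) 𝓘(ℝ, EQ) ∞ (fun k : K => q <• k) :=
  hact.comp (contMDiff_const.prodMk contMDiff_id)

theorem contMDiff_act_left
    (hact : ContMDiff (𝓘(ℝ, EQ).prod 𝓘(ℝ, EK)) 𝓘(ℝ, EQ) ∞ (fun z : Q × K => z.1 <• z.2)) (k : K) :
    ContMDiff 𝓘(ℝ, EQ) 𝓘(ℝ, EQ) ∞ (fun q : Q => q <• k) :=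
  hact.comp (contMDiff_id.prodMk contMDiff_const)

theorem modelDeriv_proj_modelFund {EB B : Type*} [NormedAddCommGroup EB] [NormedSpace ℝ EB]
    [TopologicalSpace B] [ChartedSpace EB B] {π : Q → B}
    (hact : ContMDiff (𝓘(ℝ, EQ).prod 𝓘(ℝ, EK)) 𝓘(ℝ, EQ) ∞ (fun z : Q × K => z.1 <• z.2))
    (hπ : ContMDiff 𝓘(ℝ, EQ) 𝓘(ℝ, EB) ∞ π) (hinv : ∀ (q : Q) (k : K), π (q <• k) = π q)
    (q : Q) (ξ : EK) : modelDeriv 𝓘(ℝ, EQ) 𝓘(ℝ, EB) π q (modelFund EK EQ K q ξ) = 0 := by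
  rw [modelFund, ← modelDeriv_comp_apply (g := π) (hπ.mdifferentiableAt (by simp))
    ((contMDiff_act_right hact q).mdifferentiableAt (by simp)) (by simp)]
  simp only [hinv, modelDeriv_const]
  rfl

theorem modelDeriv_map_modelFund {EQ' Q' : Type*} [NormedAddCommGroup EQ'] [NormedSpace ℝ EQ']
    [TopologicalSpace Q'] [ChartedSpace EQ' Q'] [MulAction Kᵐᵒᵖ Q'] {i : Q → Q'}
    (hact : ContMDiff (𝓘(ℝ, EQ).prod 𝓘(ℝ, EK)) 𝓘(ℝ, EQ) ∞ (fun z : Q × K => z.1 <• z.2))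
    (hi : ContMDiff 𝓘(ℝ, EQ) 𝓘(ℝ, EQ') ∞ i) (hequiv : ∀ (q : Q) (k : K), i (q <• k) = i q <• k)
    (q : Q) (ξ : EK) :
    modelDeriv 𝓘(ℝ, EQ) 𝓘(ℝ, EQ') i q (modelFund EK EQ K q ξ) = modelFund EK EQ' K (i q) ξ := by
  rw [modelFund, ← modelDeriv_comp_apply (g := i) (hi.mdifferentiableAt (by simp))
    ((contMDiff_act_right hact q).mdifferentiableAt (by simp)) (by simp)]
  simp only [hequiv]
  rfl

/-- Differentiate (q l) k = (q k)(k⁻¹ l k) in l at 1. -/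
theorem modelDeriv_act_modelFund [LieGroup 𝓘(ℝ, EK) ∞ K]
    (hact : ContMDiff (𝓘(ℝ, EQ).prod 𝓘(ℝ, EK)) 𝓘(ℝ, EQ) ∞ (fun z : Q × K => z.1 <• z.2))
    (q : Q) (k : K) (ξ : EK) :
    modelDeriv 𝓘(ℝ, EQ) 𝓘(ℝ, EQ) (fun q' : Q => q' <• k) q (modelFund EK EQ K q ξ) =
      modelFund EK EQ K (q <• k) (adMap EK k⁻¹ ξ) := by
  rw [modelFund, ← modelDeriv_comp_apply (g := fun q' : Q => q' <• k)
    ((contMDiff_act_left hact k).mdifferentiableAt (by simp))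
    ((contMDiff_act_right hact q).mdifferentiableAt (by simp)) (by simp), modelFund, adMap,
    ← modelDeriv_comp_apply (g := fun l : K => q <• k <• l)
    ((contMDiff_act_right hact _).mdifferentiableAt (by simp))
    ((contMDiff_conj k⁻¹).mdifferentiableAt (by simp)) (by simp)]
  simp only [← act_mul]
  simp [mul_assoc]

/-- Subtraction of a fundamental vector that depends smoothly on a tangent vector is smooth. -/
theorem contMDiffAt_sub_modelFund [IsManifold 𝓘(ℝ, EQ) ∞ Q] [LieGroup 𝓘(ℝ, EK) ∞ K]
    (hact : ContMDiff (𝓘(ℝ, EQ).prod 𝓘(ℝ, EK)) 𝓘(ℝ, EQ) ∞ (fun z : Q × K => z.1 <• z.2))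
    {θ : TangentBundle 𝓘(ℝ, EQ) Q → EK} {w : TangentBundle 𝓘(ℝ, EQ) Q}
    (hθ : ContMDiffAt 𝓘(ℝ, EQ).tangent 𝓘(ℝ, EK) ∞ θ w) :
    ContMDiffAt 𝓘(ℝ, EQ).tangent 𝓘(ℝ, EQ).tangent ∞
      (fun v => tangentMk 𝓘(ℝ, EQ) v.proj (modelVec v - modelFund EK EQ K v.proj (θ v))) w := by
  -- At `(q, 1)` the derivative of the action sends `(w, -ζ)` to `w` minus the fundamental vector of
  -- `ζ`, so the tangent map of the action yields the required map.
  have h1 : ContMDiffAt 𝓘(ℝ, EQ).tangent 𝓘(ℝ, EK).tangent ∞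
      (fun v => tangentMk 𝓘(ℝ, EK) (1 : K) (-θ v)) w :=
    contMDiffAt_tangentMk_const_iff.2 hθ.neg
  have h2 : ContMDiffAt 𝓘(ℝ, EQ).tangent 𝓘(ℝ, EQ).tangent ∞
      (fun v : TangentBundle 𝓘(ℝ, EQ) Q => tangentMk 𝓘(ℝ, EQ) v.proj (modelVec v)) w :=
    contMDiffAt_id
  have h3 := contMDiffAt_tangentMk_prod h2 h1
  have h4 := (contMDiffAt_tangentMap isOpen_univ hact.contMDiffOn
    (w := tangentMk (𝓘(ℝ, EQ).prod 𝓘(ℝ, EK)) (w.proj, (1 : K)) (modelVec w, -θ w))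
    (mem_univ _)).comp w h3
  refine h4.congr_of_eventuallyEq (Eventually.of_forall fun v => ?_)
  have hb : v.proj <• (1 : K) = v.proj := by simp
  have hv : modelDeriv (𝓘(ℝ, EQ).prod 𝓘(ℝ, EK)) 𝓘(ℝ, EQ) (fun z : Q × K => z.1 <• z.2)
      (v.proj, 1) (modelVec v, -θ v) = modelVec v - modelFund EK EQ K v.proj (θ v) := by
    rw [modelDeriv_prod (hact.mdifferentiableAt (by simp))]
    simp only [MulOpposite.op_one, one_smul, modelDeriv_id, map_neg, sub_eq_add_neg]
    rfl
  change _ = tangentMk 𝓘(ℝ, EQ) (v.proj <• (1 : K)) (modelDeriv (𝓘(ℝ, EQ).prod 𝓘(ℝ, EK)) 𝓘(ℝ, EQ)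
    (fun z : Q × K => z.1 <• z.2) (v.proj, 1) (modelVec v, -θ v))
  rw [hv, hb]

end Action

/-! ### Equivariant local maps to the group and the form of a principal connection -/

section Principal

variable {EK EQ EB K Q B : Type*}
  [NormedAddCommGroup EK] [NormedSpace ℝ EK] [NormedAddCommGroup EQ] [NormedSpace ℝ EQ]
  [NormedAddCommGroup EB] [NormedSpace ℝ EB]
  [Group K] [TopologicalSpace K] [ChartedSpace EK K] [LieGroup 𝓘(ℝ, EK) ∞ K]
  [TopologicalSpace Q] [ChartedSpace EQ Q] [IsManifold 𝓘(ℝ, EQ) ∞ Q] [MulAction Kᵐᵒᵖ Q]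
  [TopologicalSpace B] [ChartedSpace EB B] {π : Q → B}

omit [LieGroup 𝓘(ℝ, EK) ∞ K] [IsManifold 𝓘(ℝ, EQ) ∞ Q] in
/-- Around every point there is a smooth equivariant map to the group, and a vertical vector is
determined by its image. -/
theorem IsPrincipalBundle.exists_equivariant_map (hP : IsPrincipalBundle EK EQ EB K π) (q₀ : Q) :
    ∃ (U : Set Q) (τ : Q → K), IsOpen U ∧ q₀ ∈ U ∧ (∀ q ∈ U, ∀ k : K, q <• k ∈ U) ∧
      ContMDiffOn 𝓘(ℝ, EQ) 𝓘(ℝ, EK) ∞ τ U ∧ (∀ q ∈ U, ∀ k : K, τ (q <• k) = τ q * k) ∧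
      ∀ q ∈ U, ∀ w : EQ, modelDeriv 𝓘(ℝ, EQ) 𝓘(ℝ, EB) π q w = 0 →
        modelDeriv 𝓘(ℝ, EQ) 𝓘(ℝ, EQ) (fun y => q <• ((τ q)⁻¹ * τ y)) q w = w := by
  obtain ⟨U, hU, hq₀, z, τ, hz, hτ, hπz, hzτ⟩ := hP.locally_trivial (π q₀)
  have hUo : IsOpen (π ⁻¹' U) := hU.preimage hP.contMDiff_proj.continuous
  refine ⟨π ⁻¹' U, τ, hUo, hq₀, ?_, hτ, ?_, ?_⟩
  · intro q hq k
    rwa [mem_preimage, hP.proj_act]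
  · intro q hq k
    have h1 := hzτ (q <• k) (by rwa [mem_preimage, hP.proj_act])
    rw [hP.proj_act] at h1
    -- Both `τ (q <• k)` and `τ q * k` carry `z (π q)` to `q <• k`, and the action is free.
    have h3 : z (π q) <• (τ (q <• k) * (τ q * k)⁻¹) = z (π q) := by
      rw [act_mul, h1, mul_inv_rev, ← act_mul, mul_inv_cancel_left, act_inv_eq (hzτ q hq)]
    exact eq_of_mul_inv_eq_one (hP.free _ _ h3)
  · intro q hq w hw
    have dz := (hz.contMDiffAt (hU.mem_nhds hq)).mdifferentiableAt (by simp)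
    have dτ := (hτ.contMDiffAt (hUo.mem_nhds hq)).mdifferentiableAt (by simp)
    have dπ := hP.contMDiff_proj.mdifferentiableAt (x := q) (by simp)
    have dact := hP.contMDiff_act.mdifferentiableAt (x := (z (π q), τ q)) (by simp)
    -- Differentiate `z (π y) <• τ y = y` along the vertical `w`: the section contributes nothing,
    -- so the variation of τ alone produces `w`.
    have e1 : modelDeriv 𝓘(ℝ, EQ) 𝓘(ℝ, EQ) (fun y => z (π y) <• τ y) q w = w := by
      rw [modelDeriv_congr (g := fun y => y)
        (by filter_upwards [hUo.mem_nhds hq] using hzτ), modelDeriv_id]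
      rfl
    have dzπ : MDifferentiableAt 𝓘(ℝ, EQ) 𝓘(ℝ, EQ) (fun y => z (π y)) q := dz.comp q dπ
    have e2 : modelDeriv 𝓘(ℝ, EQ) 𝓘(ℝ, EQ) (fun y => z (π y)) q w = 0 := by
      rw [modelDeriv_comp_apply dz dπ rfl, hw, map_zero]
    rw [modelDeriv_comp_apply (g := fun y : Q × K => y.1 <• y.2) (f := fun y => (z (π y), τ y))
      dact (dzπ.prodMk dτ) rfl, modelDeriv_prodMk dzπ dτ, e2] at e1
    have e3 : (fun y => q <• ((τ q)⁻¹ * τ y)) = fun y => z (π q) <• τ y := by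
      ext y
      rw [act_mul, act_inv_eq (hzτ q hq)]
    rw [e3, modelDeriv_comp_apply (g := fun y : Q × K => y.1 <• y.2) (f := fun y => (z (π q), τ y))
      dact (mdifferentiableAt_const.prodMk dτ) rfl,
      modelDeriv_prodMk mdifferentiableAt_const dτ, modelDeriv_const]
    exact e1

/-- Around every point there is a smooth form with values in the Lie algebra that inverts the
fundamental vectors. -/
theorem IsPrincipalBundle.exists_vertical_form (hP : IsPrincipalBundle EK EQ EB K π) (q₀ : Q) :
    ∃ (U : Set Q) (κ : Q → EQ →L[ℝ] EK), IsOpen U ∧ q₀ ∈ U ∧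
      (∀ q ∈ U, ∀ ξ, κ q (modelFund EK EQ K q ξ) = ξ) ∧
      (∀ q ∈ U, ∀ w, modelDeriv 𝓘(ℝ, EQ) 𝓘(ℝ, EB) π q w = 0 →
        modelFund EK EQ K q (κ q w) = w) ∧
      ∀ w : TangentBundle 𝓘(ℝ, EQ) Q, w.proj ∈ U →
        ContMDiffAt 𝓘(ℝ, EQ).tangent 𝓘(ℝ, EK) ∞ (fun v => κ v.proj (modelVec v)) w := by
  obtain ⟨U, τ, hU, hq₀, hUact, hτ, hτact, hvert⟩ := hP.exists_equivariant_map q₀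
  have dm : ∀ q ∈ U, MDifferentiableAt 𝓘(ℝ, EQ) 𝓘(ℝ, EK) (fun y => (τ q)⁻¹ * τ y) q :=
    fun q hq => (contMDiffAt_const.mul
      (hτ.contMDiffAt (hU.mem_nhds hq))).mdifferentiableAt (by simp)
  -- The map `y ↦ (τ q)⁻¹ * τ y` takes `q <• k` to `k`, so its derivative at `q` inverts the
  -- fundamental vectors.
  refine ⟨U, fun q => modelDeriv 𝓘(ℝ, EQ) 𝓘(ℝ, EK) (fun y => (τ q)⁻¹ * τ y) q, hU, hq₀,
    ?_, ?_, ?_⟩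
  · intro q hq ξ
    rw [modelFund, ← modelDeriv_comp_apply (dm q hq)
      ((contMDiff_act_right hP.contMDiff_act q).mdifferentiableAt (by simp)) (by simp)]
    simp only [hτact q hq, inv_mul_cancel_left, modelDeriv_id]
    rfl
  · intro q hq w hw
    rw [modelFund, ← modelDeriv_comp_apply (g := fun k : K => q <• k)
      ((contMDiff_act_right hP.contMDiff_act q).mdifferentiableAt (by simp)) (dm q hq) (by simp)]
    exact hvert q hq w hw
  · intro w hw
    rw [← contMDiffAt_tangentMk_const_iff (I := 𝓘(ℝ, EK)) (x := (1 : K))]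
    -- The point `q` enters both as a parameter and as the point of differentiation. Two variables
    -- separate these roles; on the diagonal the value is constantly 1.
    have hΨ : ContMDiffOn (𝓘(ℝ, EQ).prod 𝓘(ℝ, EQ)) 𝓘(ℝ, EK) ∞
        (fun z : Q × Q => (τ z.1)⁻¹ * τ z.2) (U ×ˢ U) :=
      ((hτ.comp contMDiffOn_fst (fun z hz => hz.1)).inv).mul
        (hτ.comp contMDiffOn_snd (fun z hz => hz.2))
    have h1 : ContMDiffAt 𝓘(ℝ, EQ).tangent 𝓘(ℝ, EQ).tangent ∞
        (fun v : TangentBundle 𝓘(ℝ, EQ) Q => tangentMk 𝓘(ℝ, EQ) v.proj (0 : EQ)) w :=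
      (contMDiff_tangentMk_zero.comp contMDiff_tangentBundle_proj).contMDiffAt
    have h2 : ContMDiffAt 𝓘(ℝ, EQ).tangent 𝓘(ℝ, EQ).tangent ∞
        (fun v : TangentBundle 𝓘(ℝ, EQ) Q => tangentMk 𝓘(ℝ, EQ) v.proj (modelVec v)) w :=
      contMDiffAt_id
    have h4 := (contMDiffAt_tangentMap (hU.prod hU) hΨ
      (w := tangentMk (𝓘(ℝ, EQ).prod 𝓘(ℝ, EQ)) (w.proj, w.proj) (0, modelVec w))
      ⟨hw, hw⟩).comp w (contMDiffAt_tangentMk_prod h1 h2)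
    refine h4.congr_of_eventuallyEq ?_
    filter_upwards [(hU.preimage contMDiff_tangentBundle_proj.continuous).mem_nhds hw] with v hv
    replace hv : v.proj ∈ U := hv
    have hd : modelDeriv (𝓘(ℝ, EQ).prod 𝓘(ℝ, EQ)) 𝓘(ℝ, EK) (fun z : Q × Q => (τ z.1)⁻¹ * τ z.2)
        (v.proj, v.proj) (0, modelVec v) =
        modelDeriv 𝓘(ℝ, EQ) 𝓘(ℝ, EK) (fun y => (τ v.proj)⁻¹ * τ y) v.proj (modelVec v) := by
      rw [modelDeriv_prod ((hΨ.contMDiffAt ((hU.prod hU).mem_nhds ⟨hv, hv⟩)).mdifferentiableAt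
        (by simp)), map_zero, zero_add]
    change _ = tangentMk 𝓘(ℝ, EK) ((τ v.proj)⁻¹ * τ v.proj)
      (modelDeriv (𝓘(ℝ, EQ).prod 𝓘(ℝ, EQ)) 𝓘(ℝ, EK) (fun z : Q × Q => (τ z.1)⁻¹ * τ z.2)
        (v.proj, v.proj) (0, modelVec v))
    rw [hd, inv_mul_cancel]

/-- The horizontal projectors of a connection, as operators of the model space. -/
def modelHor (A : Conn EQ EB π) (q : Q) : EQ →L[ℝ] EQ := A.hor q

/-- A `K`-connection has a smooth equivariant connection form. -/
theorem PrincipalConn.exists_connForm (hP : IsPrincipalBundle EK EQ EB K π)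
    (A : PrincipalConn EQ EB K π) :
    ∃ ϑ : Q → EQ →L[ℝ] EK,
      (∀ q w, modelFund EK EQ K q (ϑ q w) = w - modelHor A.toConn q w) ∧
      (∀ q ξ, ϑ q (modelFund EK EQ K q ξ) = ξ) ∧
      (ContMDiff 𝓘(ℝ, EQ).tangent 𝓘(ℝ, EK) ∞
        fun v : TangentBundle 𝓘(ℝ, EQ) Q => ϑ v.proj (modelVec v)) ∧
      ∀ q (k : K) w, ϑ (q <• k) (modelDeriv 𝓘(ℝ, EQ) 𝓘(ℝ, EQ) (fun q' : Q => q' <• k) q w) =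
        adMap EK k⁻¹ (ϑ q w) := by
  choose U κ hU hmem hκ1 hκ2 hκs using hP.exists_vertical_form
  have hvert : ∀ q w, modelDeriv 𝓘(ℝ, EQ) 𝓘(ℝ, EB) π q (w - modelHor A.toConn q w) = 0 := by
    intro q w
    rw [map_sub, sub_eq_zero]
    exact (A.proj_hor q w).symm
  have hinj : ∀ q, Function.Injective (modelFund EK EQ K q) := fun q =>
    Function.LeftInverse.injective (hκ1 q q (hmem q))
  have hspec : ∀ q w, modelFund EK EQ K q (κ q q (w - modelHor A.toConn q w)) =
      w - modelHor A.toConn q w := fun q w => hκ2 q q (hmem q) _ (hvert q w)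
  -- Each point uses its own local form. Two local forms agree on vertical vectors by injectivity of
  -- the fundamental vectors, which gives smoothness from one fixed local form.
  refine ⟨fun q => (κ q q).comp (ContinuousLinearMap.id ℝ EQ - modelHor A.toConn q),
    hspec, ?_, ?_, ?_⟩
  · intro q ξ
    have h0 : modelHor A.toConn q (modelFund EK EQ K q ξ) = 0 :=
      A.hor_vertical q _ (modelDeriv_proj_modelFund hP.contMDiff_act hP.contMDiff_proj
        hP.proj_act q ξ)
    simp [h0, hκ1 q q (hmem q)]
  · intro w
    have hs := hκs w.proj w (hmem w.proj)
    have hs' := (hκs w.proj (tangentMk 𝓘(ℝ, EQ) w.proj (modelHor A.toConn w.proj (modelVec w)))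
      (hmem w.proj)).comp w (A.smooth w)
    refine (hs.sub hs').congr_of_eventuallyEq ?_
    filter_upwards [((hU w.proj).preimage contMDiff_tangentBundle_proj.continuous).mem_nhds
      (hmem w.proj)] with v hv
    apply hinj v.proj
    refine (hspec _ _).trans ?_
    have := hκ2 w.proj v.proj hv _ (hvert v.proj (modelVec v))
    rw [map_sub] at this
    exact this.symm
  · intro q k w
    apply hinj
    refine (hspec _ _).trans ?_
    rw [← modelDeriv_act_modelFund hP.contMDiff_act]
    refine Eq.trans ?_ (congrArg _ (hspec q w).symm)
    rw [map_sub]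
    exact congrArg _ (A.equivariant k q w).symm

end Principal

/-! ### Principal connections from connection forms -/

section OfConnForm

variable {EK EP EQ EB K P Q B : Type*}
  [NormedAddCommGroup EK] [NormedSpace ℝ EK] [NormedAddCommGroup EP] [NormedSpace ℝ EP]
  [NormedAddCommGroup EQ] [NormedSpace ℝ EQ] [NormedAddCommGroup EB] [NormedSpace ℝ EB]
  [Group K] [TopologicalSpace K] [ChartedSpace EK K] [LieGroup 𝓘(ℝ, EK) ∞ K]
  [TopologicalSpace P] [ChartedSpace EP P] [IsManifold 𝓘(ℝ, EP) ∞ P] [MulAction Kᵐᵒᵖ P]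
  [TopologicalSpace Q] [ChartedSpace EQ Q] [IsManifold 𝓘(ℝ, EQ) ∞ Q] [MulAction Kᵐᵒᵖ Q]
  [TopologicalSpace B] [ChartedSpace EB B] {ϖ : Q → B} {i : Q → P}

/-- The restriction of a connection form `θ` on `P` along an equivariant immersion `i : Q → P` is the
connection form of a connection on `Q → B`, provided that the vertical vectors of `Q` are sent by
`di` to fundamental vectors of `P`. -/
theorem exists_principalConn_of_connForm
    (hactP : ContMDiff (𝓘(ℝ, EP).prod 𝓘(ℝ, EK)) 𝓘(ℝ, EP) ∞ (fun z : P × K => z.1 <• z.2))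
    (hactQ : ContMDiff (𝓘(ℝ, EQ).prod 𝓘(ℝ, EK)) 𝓘(ℝ, EQ) ∞ (fun z : Q × K => z.1 <• z.2))
    (hi : ContMDiff 𝓘(ℝ, EQ) 𝓘(ℝ, EP) ∞ i) (hequiv : ∀ (q : Q) (k : K), i (q <• k) = i q <• k)
    (hinj : ∀ q, Function.Injective (modelDeriv 𝓘(ℝ, EQ) 𝓘(ℝ, EP) i q))
    (hϖ : ContMDiff 𝓘(ℝ, EQ) 𝓘(ℝ, EB) ∞ ϖ) (hinv : ∀ (q : Q) (k : K), ϖ (q <• k) = ϖ q)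
    (hvert : ∀ q w, modelDeriv 𝓘(ℝ, EQ) 𝓘(ℝ, EB) ϖ q w = 0 →
      ∃ ζ, modelDeriv 𝓘(ℝ, EQ) 𝓘(ℝ, EP) i q w = modelFund EK EP K (i q) ζ)
    {θ : P → EP →L[ℝ] EK} (hθ : ∀ p ζ, θ p (modelFund EK EP K p ζ) = ζ)
    (hθs : ContMDiff 𝓘(ℝ, EP).tangent 𝓘(ℝ, EK) ∞
      fun v : TangentBundle 𝓘(ℝ, EP) P => θ v.proj (modelVec v))
    (hθe : ∀ p (k : K) w,
      θ (p <• k) (modelDeriv 𝓘(ℝ, EP) 𝓘(ℝ, EP) (fun p' : P => p' <• k) p w) =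
        adMap EK k⁻¹ (θ p w)) :
    ∃ α : PrincipalConn EQ EB K ϖ, ∀ q w,
      modelDeriv 𝓘(ℝ, EQ) 𝓘(ℝ, EP) i q (modelHor α.toConn q w) =
        modelDeriv 𝓘(ℝ, EQ) 𝓘(ℝ, EP) i q w -
          modelFund EK EP K (i q) (θ (i q) (modelDeriv 𝓘(ℝ, EQ) 𝓘(ℝ, EP) i q w)) := by
  -- The subtraction is made on `Q`. Since `di` is injective and carries fundamental vectors to
  -- fundamental vectors, the vanishing on vertical vectors and the equivariance can be tested in
  -- `P`.
  set hor : Q → EQ →L[ℝ] EQ := fun q => ContinuousLinearMap.id ℝ EQ -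
    (modelFund EK EQ K q).comp ((θ (i q)).comp (modelDeriv 𝓘(ℝ, EQ) 𝓘(ℝ, EP) i q)) with hhor
  have hhor_apply : ∀ q w, hor q w = w - modelFund EK EQ K q
      (θ (i q) (modelDeriv 𝓘(ℝ, EQ) 𝓘(ℝ, EP) i q w)) := fun q w => rfl
  have hdi : ∀ q w, modelDeriv 𝓘(ℝ, EQ) 𝓘(ℝ, EP) i q (hor q w) =
      modelDeriv 𝓘(ℝ, EQ) 𝓘(ℝ, EP) i q w -
        modelFund EK EP K (i q) (θ (i q) (modelDeriv 𝓘(ℝ, EQ) 𝓘(ℝ, EP) i q w)) := by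
    intro q w
    rw [hhor_apply, map_sub, modelDeriv_map_modelFund hactQ hi hequiv]
  have hproj : ∀ q w, modelDeriv 𝓘(ℝ, EQ) 𝓘(ℝ, EB) ϖ q (hor q w) =
      modelDeriv 𝓘(ℝ, EQ) 𝓘(ℝ, EB) ϖ q w := by
    intro q w
    rw [hhor_apply, map_sub, modelDeriv_proj_modelFund hactQ hϖ hinv, sub_zero]
  have hzero : ∀ q w, modelDeriv 𝓘(ℝ, EQ) 𝓘(ℝ, EB) ϖ q w = 0 → hor q w = 0 := by
    intro q w hw
    obtain ⟨ζ, hζ⟩ := hvert q w hw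
    apply hinj q
    rw [hdi, hζ, hθ, sub_self, map_zero]
  have hRi : ∀ (k : K) (q : Q) (w : EQ), modelDeriv 𝓘(ℝ, EQ) 𝓘(ℝ, EP) i (q <• k)
      (modelDeriv 𝓘(ℝ, EQ) 𝓘(ℝ, EQ) (fun q' : Q => q' <• k) q w) =
      modelDeriv 𝓘(ℝ, EP) 𝓘(ℝ, EP) (fun p : P => p <• k) (i q)
        (modelDeriv 𝓘(ℝ, EQ) 𝓘(ℝ, EP) i q w) := by
    intro k q w
    rw [← modelDeriv_comp_apply (g := i) (f := fun q' : Q => q' <• k)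
      (hi.mdifferentiableAt (by simp))
      ((contMDiff_act_left hactQ k).mdifferentiableAt (by simp)) rfl,
      ← modelDeriv_comp_apply (g := fun p : P => p <• k) (f := i)
      ((contMDiff_act_left hactP k).mdifferentiableAt (by simp))
      (hi.mdifferentiableAt (by simp)) rfl]
    simp only [hequiv]
  have hR : ∀ (k : K) (q : Q) (w : EQ),
      modelDeriv 𝓘(ℝ, EQ) 𝓘(ℝ, EQ) (fun q' : Q => q' <• k) q (hor q w) =
        hor (q <• k) (modelDeriv 𝓘(ℝ, EQ) 𝓘(ℝ, EQ) (fun q' : Q => q' <• k) q w) := by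
    intro k q w
    apply hinj
    rw [hdi, hRi, hRi, hdi, map_sub, modelDeriv_act_modelFund hactP, hequiv, hθe]
  have hsmooth : ContMDiff 𝓘(ℝ, EQ).tangent 𝓘(ℝ, EQ).tangent ∞
      (fun v : TangentBundle 𝓘(ℝ, EQ) Q => tangentMk 𝓘(ℝ, EQ) v.proj (hor v.proj (modelVec v))) := by
    intro w
    refine contMDiffAt_sub_modelFund (K := K) hactQ
      (θ := fun v => θ (i v.proj) (modelDeriv 𝓘(ℝ, EQ) 𝓘(ℝ, EP) i v.proj (modelVec v))) ?_
    exact (hθs _).comp w (contMDiffAt_tangentMap isOpen_univ hi.contMDiffOn (mem_univ _))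
  exact ⟨{ hor := hor, proj_hor := hproj, hor_vertical := hzero, smooth := hsmooth,
           equivariant := hR }, hdi⟩

end OfConnForm

/-! ### The quotient by a subgroup -/

section Subgroup

variable {EG EH EX EP ES G X P : Type*}
  [NormedAddCommGroup EG] [NormedSpace ℝ EG] [NormedAddCommGroup EH] [NormedSpace ℝ EH]
  [NormedAddCommGroup EX] [NormedSpace ℝ EX] [NormedAddCommGroup EP] [NormedSpace ℝ EP]
  [NormedAddCommGroup ES] [NormedSpace ℝ ES]
  [Group G] [TopologicalSpace G] [ChartedSpace EG G] [LieGroup 𝓘(ℝ, EG) ∞ G]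
  {H : Subgroup G} [ChartedSpace EH H] [LieGroup 𝓘(ℝ, EH) ∞ H]
  [TopologicalSpace X] [ChartedSpace EX X]
  [TopologicalSpace P] [ChartedSpace EP P] [MulAction Gᵐᵒᵖ P]

omit [LieGroup 𝓘(ℝ, EG) ∞ G] [LieGroup 𝓘(ℝ, EH) ∞ H] in
theorem contMDiff_subgroup_act
    (hact : ContMDiff (𝓘(ℝ, EP).prod 𝓘(ℝ, EG)) 𝓘(ℝ, EP) ∞ (fun z : P × G => z.1 <• z.2))
    (hH : ContMDiff 𝓘(ℝ, EH) 𝓘(ℝ, EG) ∞ (Subtype.val : H → G)) :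
    ContMDiff (𝓘(ℝ, EP).prod 𝓘(ℝ, EH)) 𝓘(ℝ, EP) ∞ (fun z : P × H => z.1 <• z.2) :=
  hact.comp (contMDiff_fst.prodMk (hH.comp contMDiff_snd))

omit [LieGroup 𝓘(ℝ, EG) ∞ G] [LieGroup 𝓘(ℝ, EH) ∞ H] in
theorem modelFund_subgroup
    (hact : ContMDiff (𝓘(ℝ, EP).prod 𝓘(ℝ, EG)) 𝓘(ℝ, EP) ∞ (fun z : P × G => z.1 <• z.2))
    (hH : ContMDiff 𝓘(ℝ, EH) 𝓘(ℝ, EG) ∞ (Subtype.val : H → G)) (p : P) (ζ : EH) :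
    modelFund EH EP H p ζ = modelFund EG EP G p
      (modelDeriv 𝓘(ℝ, EH) 𝓘(ℝ, EG) (Subtype.val : H → G) 1 ζ) := by
  rw [modelFund, modelFund, ← modelDeriv_comp_apply (g := fun g : G => p <• g) (x := (1 : H)) (y := (1 : G))
    ((contMDiff_act_right hact p).mdifferentiableAt (by simp))
    (hH.mdifferentiableAt (by simp)) rfl]
  rfl

/-- The inclusion of `H` intertwines conjugation by `k` in the two groups. -/
theorem modelDeriv_val_adMap (hH : ContMDiff 𝓘(ℝ, EH) 𝓘(ℝ, EG) ∞ (Subtype.val : H → G))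
    (k : H) (ζ : EH) :
    modelDeriv 𝓘(ℝ, EH) 𝓘(ℝ, EG) (Subtype.val : H → G) 1 (adMap EH k ζ) =
      adMap EG (k : G) (modelDeriv 𝓘(ℝ, EH) 𝓘(ℝ, EG) (Subtype.val : H → G) 1 ζ) := by
  rw [adMap, adMap, ← modelDeriv_comp_apply (g := (Subtype.val : H → G))
    (f := fun l : H => k * l * k⁻¹) (hH.mdifferentiableAt (by simp))
    ((contMDiff_conj k).mdifferentiableAt (by simp)) (by simp),
    ← modelDeriv_comp_apply (g := fun x : G => (k : G) * x * (k : G)⁻¹) (x := (1 : H)) (y := (1 : G))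
    ((contMDiff_conj (k : G)).mdifferentiableAt (by simp)) (hH.mdifferentiableAt (by simp)) rfl]
  rfl

omit [LieGroup 𝓘(ℝ, EH) ∞ H] in
/-- The vertical vectors of `P → P/H` are the fundamental vectors of `H`. -/
theorem exists_modelFund_eq_of_modelDeriv_orbitMk_eq_zero {π : P → X}
    (hP : IsPrincipalBundle EG EP EX G π)
    (hH : IsSmoothEmbedding 𝓘(ℝ, EH) 𝓘(ℝ, EG) ∞ (Subtype.val : H → G))
    [ChartedSpace ES (OrbitSpace H P)]
    (hS : IsSubmersion 𝓘(ℝ, EP) 𝓘(ℝ, ES) ∞ (orbitMk H : P → OrbitSpace H P)) (p : P) (w : EP)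
    (hw : modelDeriv 𝓘(ℝ, EP) 𝓘(ℝ, ES) (orbitMk H : P → OrbitSpace H P) p w = 0) :
    ∃ ζ, w = modelFund EH EP H p ζ := by
  classical
  obtain ⟨ρ, hρ, hρp, hρf, hρw⟩ := IsSubmersion.exists_fibre_retraction hS p
  obtain ⟨U, τ, hU, hpU, -, hτ, hτact, -⟩ := hP.exists_equivariant_map p
  -- The default 1 plays no role near `p`: there `ρ y` lies in the orbit of `p` under `H`, so the
  -- first case holds.
  set κ : P → H := fun y => if h : (τ p)⁻¹ * τ (ρ y) ∈ H then ⟨_, h⟩ else 1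
  have hev : ∀ᶠ y in 𝓝 p, ρ y = p <• (κ y) ∧ (κ y : G) = (τ p)⁻¹ * τ (ρ y) := by
    filter_upwards [hρf] with y hy
    obtain ⟨k, hk⟩ : ∃ k : H, ρ y = p <• k :=
      Quotient.exact (s := orbitSetoid H P) hy.symm
    have h1 : (τ p)⁻¹ * τ (ρ y) = k := by
      rw [hk, subgroup_act_def, hτact p hpU, inv_mul_cancel_left]
    have h2 : κ y = k := by
      simp only [κ, h1]
      simp
    rw [h2, h1]
    exact ⟨hk, rfl⟩
  have hsm : ContMDiffAt 𝓘(ℝ, EP) 𝓘(ℝ, EG) ∞ (fun y => (κ y : G)) p := by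
    have h1 : ContMDiffAt 𝓘(ℝ, EP) 𝓘(ℝ, EG) ∞ (fun y => τ (ρ y)) p :=
      ContMDiffAt.comp p (by rw [hρp]; exact hτ.contMDiffAt (hU.mem_nhds hpU)) hρ
    have h2 : ContMDiffAt 𝓘(ℝ, EP) 𝓘(ℝ, EG) ∞ (fun y => (τ p)⁻¹ * τ (ρ y)) p :=
      contMDiffAt_const.mul h1
    refine h2.congr_of_eventuallyEq ?_
    filter_upwards [hev] with y hy using hy.2
  -- Smoothness into `G` passes to the embedded submanifold `H`.
  have hκ : ContMDiffAt 𝓘(ℝ, EP) 𝓘(ℝ, EH) ∞ κ p :=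
    (ContMDiffAt.iff_comp_isImmersionAt (hH.isImmersion.isImmersionAt (κ p))).2
      ⟨hH.isEmbedding.continuousAt_iff.2 hsm.continuousAt, hsm⟩
  have hκp : κ p = 1 := by
    have := hev.self_of_nhds.2
    rw [hρp, inv_mul_cancel] at this
    exact Subtype.ext this
  have hactH := contMDiff_subgroup_act hP.contMDiff_act hH.contMDiff
  -- Near `p` one has `ρ y = p <• κ y` with `κ p = 1`, and `dρ w = w`.
  refine ⟨modelDeriv 𝓘(ℝ, EP) 𝓘(ℝ, EH) κ p w, ?_⟩
  rw [modelFund, ← modelDeriv_comp_apply (g := fun k : H => p <• k)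
    ((contMDiff_act_right hactH p).mdifferentiableAt (by simp))
    (hκ.mdifferentiableAt (by simp)) hκp, ← modelDeriv_congr (f := ρ), hρw w hw]
  filter_upwards [hev] with y hy using hy.1

omit [LieGroup 𝓘(ℝ, EG) ∞ G] [LieGroup 𝓘(ℝ, EH) ∞ H] in
theorem mem_subgroupLieAlgebra {ξ : EG} :
    ξ ∈ (subgroupLieAlgebra EG EH H : Submodule ℝ (GroupLieAlgebra 𝓘(ℝ, EG) G)) ↔
      ∃ ζ : EH, modelDeriv 𝓘(ℝ, EH) 𝓘(ℝ, EG) (Subtype.val : H → G) 1 ζ = ξ :=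
  Iff.rfl

end Subgroup

/-! ### Associated connections -/

section Associated

variable {EK EQ EB EV EY K Q B V : Type*}
  [NormedAddCommGroup EK] [NormedSpace ℝ EK] [NormedAddCommGroup EQ] [NormedSpace ℝ EQ]
  [NormedAddCommGroup EB] [NormedSpace ℝ EB] [NormedAddCommGroup EV] [NormedSpace ℝ EV]
  [NormedAddCommGroup EY] [NormedSpace ℝ EY]
  [Group K] [TopologicalSpace K] [ChartedSpace EK K]
  [TopologicalSpace Q] [ChartedSpace EQ Q] [IsManifold 𝓘(ℝ, EQ) ∞ Q] [MulAction Kᵐᵒᵖ Q]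
  [TopologicalSpace B] [ChartedSpace EB B] {π : Q → B}
  [TopologicalSpace V] [ChartedSpace EV V] [IsManifold 𝓘(ℝ, EV) ∞ V] [MulAction K V]
  [ContMDiffSMul 𝓘(ℝ, EK) 𝓘(ℝ, EV) ∞ K V]
  [ChartedSpace EY (Assoc K Q V)] [IsManifold 𝓘(ℝ, EY) ∞ (Assoc K Q V)]

omit [TopologicalSpace K] [TopologicalSpace Q] [TopologicalSpace V] in
theorem assocMk_surjective : Function.Surjective (assocMk K : Q × V → Assoc K Q V) :=
  Quotient.mk_surjective

omit [TopologicalSpace K] [TopologicalSpace Q] [TopologicalSpace V] in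
theorem assocMk_act (a : Q × V) (k : K) :
    assocMk K (a.1 <• k, k⁻¹ • a.2) = assocMk K a :=
  (Quotient.sound (s := assocSetoid K Q V) ⟨k, rfl⟩).symm

omit [IsManifold 𝓘(ℝ, EV) ∞ V] [IsManifold 𝓘(ℝ, EY) ∞ (Assoc K Q V)] in
/-- The image of the horizontal part of a tangent vector of `Q × V` depends only on the image of
this vector. -/
theorem modelDeriv_assocMk_hor_eq
    (hact : ContMDiff (𝓘(ℝ, EQ).prod 𝓘(ℝ, EK)) 𝓘(ℝ, EQ) ∞ (fun z : Q × K => z.1 <• z.2))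
    (hπs : ContMDiff 𝓘(ℝ, EQ) 𝓘(ℝ, EB) ∞ π) (hπ : ∀ (q : Q) (k : K), π (q <• k) = π q)
    (hY : IsSubmersion (𝓘(ℝ, EQ).prod 𝓘(ℝ, EV)) 𝓘(ℝ, EY) ∞ (assocMk K : Q × V → Assoc K Q V))
    (α : PrincipalConn EQ EB K π) {a b : Q × V} (hab : assocMk K a = assocMk K b) {x y : EQ × EV}
    (hxy : modelDeriv (𝓘(ℝ, EQ).prod 𝓘(ℝ, EV)) 𝓘(ℝ, EY) (assocMk K : Q × V → Assoc K Q V) a x =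
      modelDeriv (𝓘(ℝ, EQ).prod 𝓘(ℝ, EV)) 𝓘(ℝ, EY) (assocMk K : Q × V → Assoc K Q V) b y) :
    modelDeriv (𝓘(ℝ, EQ).prod 𝓘(ℝ, EV)) 𝓘(ℝ, EY) (assocMk K : Q × V → Assoc K Q V) a
        (modelHor α.toConn a.1 x.1, 0) =
      modelDeriv (𝓘(ℝ, EQ).prod 𝓘(ℝ, EV)) 𝓘(ℝ, EY) (assocMk K : Q × V → Assoc K Q V) b
        (modelHor α.toConn b.1 y.1, 0) := by
  obtain ⟨k, rfl⟩ : ∃ k : K, b = (a.1 <• k, k⁻¹ • a.2) :=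
    Quotient.exact (s := assocSetoid K Q V) hab
  set m := fun c : Q × V =>
    modelDeriv (𝓘(ℝ, EQ).prod 𝓘(ℝ, EV)) 𝓘(ℝ, EY) (assocMk K : Q × V → Assoc K Q V) c with hm
  have hmk : ∀ c, MDifferentiableAt (𝓘(ℝ, EQ).prod 𝓘(ℝ, EV)) 𝓘(ℝ, EY)
      (assocMk K : Q × V → Assoc K Q V) c := fun c => hY.contMDiff.mdifferentiableAt (by simp)
  have hprojs : ContMDiff 𝓘(ℝ, EY) 𝓘(ℝ, EB) ∞ (assocProj V π hπ) :=
    IsSubmersion.contMDiff_of_comp hY assocMk_surjective (hπs.comp contMDiff_fst)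
  -- The map π factors through the quotient, so a vector killed by `m` has a vertical `Q`-component.
  have hker : ∀ (c : Q × V) (z : EQ × EV), m c z = 0 → modelHor α.toConn c.1 z.1 = 0 := by
    intro c z hz
    refine α.hor_vertical c.1 z.1 ?_
    change modelDeriv 𝓘(ℝ, EQ) 𝓘(ℝ, EB) π c.1 z.1 = 0
    have h1 : modelDeriv (𝓘(ℝ, EQ).prod 𝓘(ℝ, EV)) 𝓘(ℝ, EB) (fun c : Q × V => π c.1) c z = 0 := by
      have : (fun c : Q × V => π c.1) = fun c => assocProj V π hπ (assocMk K c) := rfl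
      rw [this, modelDeriv_comp_apply (hprojs.mdifferentiableAt (by simp)) (hmk c) rfl]
      change modelDeriv 𝓘(ℝ, EY) 𝓘(ℝ, EB) _ _ (m c z) = 0
      rw [hz, map_zero]
    rwa [modelDeriv_comp_apply (hπs.mdifferentiableAt (by simp)) mdifferentiableAt_fst rfl,
      modelDeriv_fst] at h1
  have dR : MDifferentiableAt 𝓘(ℝ, EQ) 𝓘(ℝ, EQ) (fun q : Q => q <• k) a.1 :=
    (contMDiff_act_left hact k).mdifferentiableAt (by simp)
  have dL : MDifferentiableAt 𝓘(ℝ, EV) 𝓘(ℝ, EV) (fun v : V => k⁻¹ • v) a.2 :=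
    ((contMDiff_smul (I := 𝓘(ℝ, EK)) (I' := 𝓘(ℝ, EV)) (n := ∞) (G := K) (M := V)).comp
      (contMDiff_const (c := k⁻¹).prodMk contMDiff_id)).mdifferentiableAt (by simp)
  set R := modelDeriv 𝓘(ℝ, EQ) 𝓘(ℝ, EQ) (fun q : Q => q <• k) a.1
  set L := modelDeriv 𝓘(ℝ, EV) 𝓘(ℝ, EV) (fun v : V => k⁻¹ • v) a.2
  have hinv : ∀ z : EQ × EV, m (a.1 <• k, k⁻¹ • a.2) (R z.1, L z.2) = m a z := by
    intro z
    have d1 : MDifferentiableAt (𝓘(ℝ, EQ).prod 𝓘(ℝ, EV)) 𝓘(ℝ, EQ) (fun c : Q × V => c.1 <• k) a :=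
      dR.comp a mdifferentiableAt_fst
    have d2 : MDifferentiableAt (𝓘(ℝ, EQ).prod 𝓘(ℝ, EV)) 𝓘(ℝ, EV) (fun c : Q × V => k⁻¹ • c.2) a :=
      dL.comp a mdifferentiableAt_snd
    have h1 : modelDeriv (𝓘(ℝ, EQ).prod 𝓘(ℝ, EV)) 𝓘(ℝ, EY)
        (fun c : Q × V => assocMk K (c.1 <• k, k⁻¹ • c.2)) a z = m a z := by
      simp only [assocMk_act]
      rfl
    rw [modelDeriv_comp_apply (f := fun c : Q × V => (c.1 <• k, k⁻¹ • c.2)) (hmk _)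
      (d1.prodMk d2) rfl, modelDeriv_prodMk d1 d2,
      modelDeriv_comp_apply (g := fun q : Q => q <• k) dR mdifferentiableAt_fst rfl,
      modelDeriv_comp_apply (g := fun v : V => k⁻¹ • v) dL mdifferentiableAt_snd rfl,
      modelDeriv_fst, modelDeriv_snd] at h1
    exact h1
  -- The vector `y` and the translate of `x` by `k` have the same image at the same point, so their
  -- difference lies in the kernel treated by `hker`.
  have h1 : modelHor α.toConn (a.1 <• k) (y.1 - R x.1) = 0 := by
    refine hker (a.1 <• k, k⁻¹ • a.2) (y - (R x.1, L x.2)) ?_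
    rw [map_sub, hinv x, sub_eq_zero]
    exact hxy.symm
  have h2 : R (modelHor α.toConn a.1 x.1) = modelHor α.toConn (a.1 <• k) (R x.1) :=
    α.equivariant k a.1 x.1
  rw [map_sub, sub_eq_zero] at h1
  change m a (modelHor α.toConn a.1 x.1, 0) =
    m (a.1 <• k, k⁻¹ • a.2) (modelHor α.toConn (a.1 <• k) y.1, 0)
  rw [← hinv, h1]
  simp only [h2, map_zero]

/-- Lift a vector by the derivative of a local section of Q × V → Y, take the horizontal part along
Q and push it forward. By `modelDeriv_assocMk_hor_eq` the result does not depend on the section, so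
the local constructions glue. -/
theorem exists_associatedConn
    (hact : ContMDiff (𝓘(ℝ, EQ).prod 𝓘(ℝ, EK)) 𝓘(ℝ, EQ) ∞ (fun z : Q × K => z.1 <• z.2))
    (hπs : ContMDiff 𝓘(ℝ, EQ) 𝓘(ℝ, EB) ∞ π) (hπ : ∀ (q : Q) (k : K), π (q <• k) = π q)
    (hY : IsSubmersion (𝓘(ℝ, EQ).prod 𝓘(ℝ, EV)) 𝓘(ℝ, EY) ∞ (assocMk K : Q × V → Assoc K Q V))
    (α : PrincipalConn EQ EB K π) :
    ∃ Γ : Conn EY EB (assocProj V π hπ), IsAssociatedConn (EV := EV) α Γ := by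
  set m := fun c : Q × V =>
    modelDeriv (𝓘(ℝ, EQ).prod 𝓘(ℝ, EV)) 𝓘(ℝ, EY) (assocMk K : Q × V → Assoc K Q V) c with hm
  have hmk : ∀ c, MDifferentiableAt (𝓘(ℝ, EQ).prod 𝓘(ℝ, EV)) 𝓘(ℝ, EY)
      (assocMk K : Q × V → Assoc K Q V) c := fun c => hY.contMDiff.mdifferentiableAt (by simp)
  have hprojs : ContMDiff 𝓘(ℝ, EY) 𝓘(ℝ, EB) ∞ (assocProj V π hπ) :=
    IsSubmersion.contMDiff_of_comp hY assocMk_surjective (hπs.comp contMDiff_fst)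
  have hprojm : ∀ (c : Q × V) (z : EQ × EV), modelDeriv 𝓘(ℝ, EY) 𝓘(ℝ, EB) (assocProj V π hπ)
      (assocMk K c) (m c z) = modelDeriv 𝓘(ℝ, EQ) 𝓘(ℝ, EB) π c.1 z.1 := by
    intro c z
    rw [hm, ← modelDeriv_comp_apply (hprojs.mdifferentiableAt (by simp)) (hmk c) rfl]
    change modelDeriv (𝓘(ℝ, EQ).prod 𝓘(ℝ, EV)) 𝓘(ℝ, EB) (fun c : Q × V => π c.1) c z = _
    rw [modelDeriv_comp_apply (hπs.mdifferentiableAt (by simp)) mdifferentiableAt_fst rfl,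
      modelDeriv_fst]
  have hsec : ∀ y : Assoc K Q V, ∃ (s : Assoc K Q V → Q × V) (U : Set (Assoc K Q V)),
      IsOpen U ∧ y ∈ U ∧ ContMDiffOn 𝓘(ℝ, EY) (𝓘(ℝ, EQ).prod 𝓘(ℝ, EV)) ∞ s U ∧
        ∀ y' ∈ U, assocMk K (s y') = y' := by
    intro y
    obtain ⟨a, rfl⟩ := assocMk_surjective y
    obtain ⟨s, U, hU, ha, -, hs, h⟩ := IsSubmersion.exists_section hY a
    exact ⟨s, U, hU, ha, hs, h⟩
  choose s U hU hmem hs hsmk using hsec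
  have ds : ∀ y, ∀ y' ∈ U y, MDifferentiableAt 𝓘(ℝ, EY) (𝓘(ℝ, EQ).prod 𝓘(ℝ, EV)) (s y) y' :=
    fun y y' hy' => ((hs y).contMDiffAt ((hU y).mem_nhds hy')).mdifferentiableAt (by simp)
  have hright : ∀ y, ∀ y' ∈ U y, ∀ w : EY,
      m (s y y') (modelDeriv 𝓘(ℝ, EY) (𝓘(ℝ, EQ).prod 𝓘(ℝ, EV)) (s y) y' w) = w := by
    intro y y' hy' w
    rw [hm, ← modelDeriv_comp_apply (hmk _) (ds y y' hy') rfl, modelDeriv_congr (g := fun z => z)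
      (by filter_upwards [(hU y).mem_nhds hy'] using hsmk y), modelDeriv_id]
    rfl
  -- The argument `y` selects the section and `y'` is the point. The connection is the diagonal
  -- `lift y y`; by `hloc` it agrees near `y` with the expression for one fixed section, which is
  -- smooth.
  set lift : (y y' : Assoc K Q V) → EY →L[ℝ] EY := fun y y' => (m (s y y')).comp
    ((ContinuousLinearMap.inl ℝ EQ EV).comp ((modelHor α.toConn (s y y').1).comp
      ((ContinuousLinearMap.fst ℝ EQ EV).comp
        (modelDeriv 𝓘(ℝ, EY) (𝓘(ℝ, EQ).prod 𝓘(ℝ, EV)) (s y) y')))) with hlift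
  have hlift_apply : ∀ y, ∀ y' ∈ U y, ∀ (c : Q × V) (z : EQ × EV), assocMk K c = y' →
      lift y y' (m c z) = m c (modelHor α.toConn c.1 z.1, 0) := by
    intro y y' hy' c z hc
    refine modelDeriv_assocMk_hor_eq hact hπs hπ hY α ((hsmk y y' hy').trans hc.symm) ?_
    exact hright y y' hy' _
  have hassoc : ∀ (c : Q × V) (z : EQ × EV), lift (assocMk K c) (assocMk K c) (m c z) =
      m c (modelHor α.toConn c.1 z.1, 0) := fun c z => hlift_apply _ _ (hmem _) c z rfl
  have hloc : ∀ y, ∀ y' ∈ U y, lift y' y' = lift y y' := by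
    intro y y' hy'
    ext w
    rw [← hright y y' hy' w, hlift_apply y' y' (hmem y') _ _ (hsmk y y' hy'),
      hlift_apply y y' hy' _ _ (hsmk y y' hy')]
  have hrep : ∀ (y : Assoc K Q V) (w : EY), ∃ (c : Q × V) (z : EQ × EV),
      assocMk K c = y ∧ m c z = w := fun y w =>
    ⟨s y y, _, hsmk y y (hmem y), hright y y (hmem y) w⟩
  have hproj : ∀ (y : Assoc K Q V) (w : EY),
      modelDeriv 𝓘(ℝ, EY) 𝓘(ℝ, EB) (assocProj V π hπ) y (lift y y w) =
        modelDeriv 𝓘(ℝ, EY) 𝓘(ℝ, EB) (assocProj V π hπ) y w := by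
    intro y w
    obtain ⟨c, z, rfl, rfl⟩ := hrep y w
    rw [hassoc, hprojm, hprojm]
    exact α.proj_hor c.1 z.1
  have hzero : ∀ (y : Assoc K Q V) (w : EY),
      modelDeriv 𝓘(ℝ, EY) 𝓘(ℝ, EB) (assocProj V π hπ) y w = 0 → lift y y w = 0 := by
    intro y w hw
    obtain ⟨c, z, rfl, rfl⟩ := hrep y w
    rw [hprojm] at hw
    have h0 : modelHor α.toConn c.1 z.1 = 0 := α.hor_vertical c.1 z.1 hw
    rw [hassoc, h0]
    exact map_zero (m c)
  have hsmooth : ContMDiff 𝓘(ℝ, EY).tangent 𝓘(ℝ, EY).tangent ∞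
      (fun v : TangentBundle 𝓘(ℝ, EY) (Assoc K Q V) =>
        tangentMk 𝓘(ℝ, EY) v.proj (lift v.proj v.proj (modelVec v))) := by
    intro w
    set y := w.proj
    have hs1 : ContMDiffOn 𝓘(ℝ, EY) 𝓘(ℝ, EQ) ∞ (fun y' => (s y y').1) (U y) :=
      contMDiff_fst.comp_contMDiffOn (hs y)
    have hs2 : ContMDiffOn 𝓘(ℝ, EY) 𝓘(ℝ, EV) ∞ (fun y' => (s y y').2) (U y) :=
      contMDiff_snd.comp_contMDiffOn (hs y)
    have h1 := (α.smooth _).comp w (contMDiffAt_tangentMap (hU y) hs1 (w := w) (hmem y))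
    have hs2w : ContMDiffAt 𝓘(ℝ, EY).tangent 𝓘(ℝ, EV) ∞
        (fun v : TangentBundle 𝓘(ℝ, EY) (Assoc K Q V) => (s y v.proj).2) w :=
      ContMDiffAt.comp (g := fun y' => (s y y').2) w
        (hs2.contMDiffAt ((hU y).mem_nhds (hmem y))) contMDiff_tangentBundle_proj.contMDiffAt
    have h2 : ContMDiffAt 𝓘(ℝ, EY).tangent 𝓘(ℝ, EV).tangent ∞
        (fun v : TangentBundle 𝓘(ℝ, EY) (Assoc K Q V) =>
          tangentMk 𝓘(ℝ, EV) (s y v.proj).2 (0 : EV)) w :=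
      (contMDiff_tangentMk_zero _).comp w hs2w
    have h3 := contMDiffAt_tangentMk_prod (I := 𝓘(ℝ, EQ)) (I' := 𝓘(ℝ, EV))
      (f := fun v : TangentBundle 𝓘(ℝ, EY) (Assoc K Q V) => (s y v.proj).1)
      (u := fun v => modelHor α.toConn (s y v.proj).1
        (modelDeriv 𝓘(ℝ, EY) 𝓘(ℝ, EQ) (fun y' => (s y y').1) v.proj (modelVec v))) h1 h2
    have h4 := (contMDiffAt_tangentMap isOpen_univ hY.contMDiff.contMDiffOn (mem_univ _)).comp w h3
    refine h4.congr_of_eventuallyEq ?_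
    filter_upwards [((hU y).preimage contMDiff_tangentBundle_proj.continuous).mem_nhds
      (hmem y)] with v hv
    replace hv : v.proj ∈ U y := hv
    change _ = tangentMk 𝓘(ℝ, EY) (assocMk K (s y v.proj)) (m (s y v.proj)
      (modelHor α.toConn (s y v.proj).1
        (modelDeriv 𝓘(ℝ, EY) 𝓘(ℝ, EQ) (fun y' => (s y y').1) v.proj (modelVec v)), 0))
    rw [modelDeriv_comp_apply mdifferentiableAt_fst (ds y v.proj hv) rfl, modelDeriv_fst,
      hsmk y v.proj hv, hloc y v.proj hv]
    rfl
  exact ⟨{ hor := fun y => lift y y, proj_hor := hproj, hor_vertical := hzero, smooth := hsmooth },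
    fun q v w u => hassoc (q, v) (w, u)⟩

omit [TopologicalSpace K] [IsManifold 𝓘(ℝ, EV) ∞ V] in
/-- If a principal connection is a pull-back, so is the associated connection. -/
theorem IsPullbackConn.assoc {EQ' EB' EY' Q' B' : Type*}
    [NormedAddCommGroup EQ'] [NormedSpace ℝ EQ'] [NormedAddCommGroup EB'] [NormedSpace ℝ EB']
    [NormedAddCommGroup EY'] [NormedSpace ℝ EY']
    [TopologicalSpace Q'] [ChartedSpace EQ' Q'] [IsManifold 𝓘(ℝ, EQ') ∞ Q'] [MulAction Kᵐᵒᵖ Q']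
    [TopologicalSpace B'] [ChartedSpace EB' B'] {π' : Q' → B'}
    [ChartedSpace EY' (Assoc K Q' V)] [IsManifold 𝓘(ℝ, EY') ∞ (Assoc K Q' V)]
    {hπ : ∀ (q : Q) (k : K), π (q <• k) = π q} {hπ' : ∀ (q : Q') (k : K), π' (q <• k) = π' q}
    (hY : IsSubmersion (𝓘(ℝ, EQ).prod 𝓘(ℝ, EV)) 𝓘(ℝ, EY) ∞ (assocMk K : Q × V → Assoc K Q V))
    (hY' : IsSubmersion (𝓘(ℝ, EQ').prod 𝓘(ℝ, EV)) 𝓘(ℝ, EY') ∞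
      (assocMk K : Q' × V → Assoc K Q' V))
    {α : PrincipalConn EQ EB K π} {α' : PrincipalConn EQ' EB' K π'}
    {Γ : Conn EY EB (assocProj V π hπ)} {Γ' : Conn EY' EB' (assocProj V π' hπ')}
    (hΓ : IsAssociatedConn (EV := EV) α Γ) (hΓ' : IsAssociatedConn (EV := EV) α' Γ')
    {i : Q' → Q} (his : ContMDiff 𝓘(ℝ, EQ') 𝓘(ℝ, EQ) ∞ i)
    (hi : ∀ (q : Q') (k : K), i (q <• k) = i q <• k)
    (hpull : IsPullbackConn i α.toConn α'.toConn) :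
    IsPullbackConn (assocMap V i hi) Γ Γ' := by
  have hmk : ∀ c, MDifferentiableAt (𝓘(ℝ, EQ).prod 𝓘(ℝ, EV)) 𝓘(ℝ, EY)
      (assocMk K : Q × V → Assoc K Q V) c := fun c => hY.contMDiff.mdifferentiableAt (by simp)
  have hmk' : ∀ c, MDifferentiableAt (𝓘(ℝ, EQ').prod 𝓘(ℝ, EV)) 𝓘(ℝ, EY')
      (assocMk K : Q' × V → Assoc K Q' V) c := fun c => hY'.contMDiff.mdifferentiableAt (by simp)
  have hmap : ContMDiff 𝓘(ℝ, EY') 𝓘(ℝ, EY) ∞ (assocMap V i hi) :=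
    IsSubmersion.contMDiff_of_comp hY' assocMk_surjective
      (hY.contMDiff.comp ((his.comp contMDiff_fst).prodMk contMDiff_snd))
  have hcomm : ∀ (c : Q' × V) (z : EQ' × EV),
      modelDeriv 𝓘(ℝ, EY') 𝓘(ℝ, EY) (assocMap V i hi) (assocMk K c)
        (modelDeriv (𝓘(ℝ, EQ').prod 𝓘(ℝ, EV)) 𝓘(ℝ, EY') (assocMk K : Q' × V → Assoc K Q' V) c z) =
      modelDeriv (𝓘(ℝ, EQ).prod 𝓘(ℝ, EV)) 𝓘(ℝ, EY) (assocMk K : Q × V → Assoc K Q V) (i c.1, c.2)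
        (modelDeriv 𝓘(ℝ, EQ') 𝓘(ℝ, EQ) i c.1 z.1, z.2) := by
    intro c z
    have di := his.mdifferentiableAt (x := c.1) (by simp)
    have d1 : MDifferentiableAt (𝓘(ℝ, EQ').prod 𝓘(ℝ, EV)) 𝓘(ℝ, EQ) (fun c : Q' × V => i c.1) c :=
      di.comp c mdifferentiableAt_fst
    rw [← modelDeriv_comp_apply (hmap.mdifferentiableAt (by simp)) (hmk' c) rfl]
    change modelDeriv (𝓘(ℝ, EQ').prod 𝓘(ℝ, EV)) 𝓘(ℝ, EY)
      (fun c : Q' × V => assocMk K (i c.1, c.2)) c z = _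
    rw [modelDeriv_comp_apply (f := fun c : Q' × V => (i c.1, c.2)) (hmk _)
      (d1.prodMk mdifferentiableAt_snd) rfl, modelDeriv_prodMk d1 mdifferentiableAt_snd,
      modelDeriv_comp_apply di mdifferentiableAt_fst rfl, modelDeriv_fst]
    congr 2
    exact modelDeriv_snd c z
  intro y w
  -- Every tangent vector of the quotient comes from `Q' × V`, where both associated connections are
  -- given by their defining formula.
  obtain ⟨c, rfl⟩ := assocMk_surjective y
  obtain ⟨z, rfl⟩ := IsSubmersion.modelDeriv_surjective hY' c w
  have h1 : modelHor Γ' (assocMk K c)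
      (modelDeriv (𝓘(ℝ, EQ').prod 𝓘(ℝ, EV)) 𝓘(ℝ, EY') (assocMk K : Q' × V → Assoc K Q' V) c z) =
      modelDeriv (𝓘(ℝ, EQ').prod 𝓘(ℝ, EV)) 𝓘(ℝ, EY') (assocMk K : Q' × V → Assoc K Q' V) c
        (modelHor α'.toConn c.1 z.1, 0) := hΓ' c.1 c.2 z.1 z.2
  have h2 : modelHor Γ (assocMk K (i c.1, c.2))
      (modelDeriv (𝓘(ℝ, EQ).prod 𝓘(ℝ, EV)) 𝓘(ℝ, EY) (assocMk K : Q × V → Assoc K Q V) (i c.1, c.2)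
        (modelDeriv 𝓘(ℝ, EQ') 𝓘(ℝ, EQ) i c.1 z.1, z.2)) =
      modelDeriv (𝓘(ℝ, EQ).prod 𝓘(ℝ, EV)) 𝓘(ℝ, EY) (assocMk K : Q × V → Assoc K Q V) (i c.1, c.2)
        (modelHor α.toConn (i c.1) (modelDeriv 𝓘(ℝ, EQ') 𝓘(ℝ, EQ) i c.1 z.1), 0) :=
    hΓ (i c.1) c.2 _ z.2
  have h3 : modelDeriv 𝓘(ℝ, EQ') 𝓘(ℝ, EQ) i c.1 (modelHor α'.toConn c.1 z.1) =
      modelHor α.toConn (i c.1) (modelDeriv 𝓘(ℝ, EQ') 𝓘(ℝ, EQ) i c.1 z.1) := hpull c.1 z.1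
  change modelDeriv 𝓘(ℝ, EY') 𝓘(ℝ, EY) (assocMap V i hi) (assocMk K c)
      (modelHor Γ' (assocMk K c) _) =
    modelHor Γ (assocMk K (i c.1, c.2))
      (modelDeriv 𝓘(ℝ, EY') 𝓘(ℝ, EY) (assocMap V i hi) (assocMk K c) _)
  rw [h1, hcomm, hcomm, h2, h3]

end Associated

/-! ### The constituent of a connection form -/

/-- The projection onto the domain of an injective map, along a complement of the range. -/
theorem exists_leftInverse_of_isCompl_range {E F : Type*} [NormedAddCommGroup E] [NormedSpace ℝ E]
    [NormedAddCommGroup F] [NormedSpace ℝ F] [FiniteDimensional ℝ F] {f : E →L[ℝ] F}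
    (hf : Function.Injective f) {p : Submodule ℝ F} (hp : IsCompl (LinearMap.range f.toLinearMap) p) :
    ∃ σ : F →L[ℝ] E, (∀ x, σ (f x) = x) ∧ (∀ y ∈ p, σ y = 0) ∧ ∀ y, y - f (σ y) ∈ p := by
  set e := LinearEquiv.ofInjective f.toLinearMap hf with he
  set σ : F →L[ℝ] E :=
    LinearMap.toContinuousLinearMap (e.symm.toLinearMap ∘ₗ Submodule.projectionOnto _ p hp)
  have h1 : ∀ x, σ (f x) = x := by
    intro x
    have : Submodule.projectionOnto _ p hp (f x) = e x :=
      Submodule.projectionOnto_apply_left hp (e x)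
    change e.symm (Submodule.projectionOnto _ p hp (f x)) = x
    rw [this, e.symm_apply_apply]
  have h2 : ∀ y ∈ p, σ y = 0 := by
    intro y hy
    change e.symm (Submodule.projectionOnto _ p hp y) = 0
    rw [(Submodule.projectionOnto_apply_eq_zero_iff hp).2 hy, map_zero]
  refine ⟨σ, h1, h2, fun y => ?_⟩
  obtain ⟨a, ⟨x, rfl⟩, b, hb, rfl⟩ := Submodule.mem_sup.1
    (hp.sup_eq_top ▸ Submodule.mem_top : y ∈ LinearMap.range f.toLinearMap ⊔ p)
  have h3 : σ (f x + b) = x := by rw [map_add, h1, h2 b hb, add_zero]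
  change f x + b - f (σ (f x + b)) ∈ p
  rwa [h3, add_sub_cancel_left]

section Constituent

variable {EG EH EX EP G X P : Type*}
  [NormedAddCommGroup EG] [NormedSpace ℝ EG] [FiniteDimensional ℝ EG]
  [NormedAddCommGroup EH] [NormedSpace ℝ EH]
  [NormedAddCommGroup EX] [NormedSpace ℝ EX] [NormedAddCommGroup EP] [NormedSpace ℝ EP]
  [Group G] [TopologicalSpace G] [ChartedSpace EG G] [LieGroup 𝓘(ℝ, EG) ∞ G]
  {H : Subgroup G} [ChartedSpace EH H] [LieGroup 𝓘(ℝ, EH) ∞ H]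
  [TopologicalSpace X] [ChartedSpace EX X]
  [TopologicalSpace P] [ChartedSpace EP P] [IsManifold 𝓘(ℝ, EP) ∞ P] [MulAction Gᵐᵒᵖ P]

/-- The `𝔥`-component of the connection form of a `G`-connection, as a form with values in the Lie
algebra of `H`, is a smooth equivariant form that reproduces the fundamental vectors of `H`. -/
theorem PrincipalConn.exists_constituent_form {π : P → X} (hP : IsPrincipalBundle EG EP EX G π)
    (hH : IsSmoothEmbedding 𝓘(ℝ, EH) 𝓘(ℝ, EG) ∞ (Subtype.val : H → G)) {𝔣 : Submodule ℝ EG}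
    (hcompl : IsCompl (LinearMap.range
      (modelDeriv 𝓘(ℝ, EH) 𝓘(ℝ, EG) (Subtype.val : H → G) 1).toLinearMap) 𝔣)
    (hAd : ∀ (k : H), ∀ η ∈ 𝔣, adMap EG (k : G) η ∈ 𝔣) (A : PrincipalConn EP EX G π) :
    ∃ θ : P → EP →L[ℝ] EH,
      (∀ p w, ∃ η ∈ 𝔣, w - modelHor A.toConn p w = modelFund EG EP G p
        (modelDeriv 𝓘(ℝ, EH) 𝓘(ℝ, EG) (Subtype.val : H → G) 1 (θ p w) + η)) ∧
      (∀ p ζ, θ p (modelFund EH EP H p ζ) = ζ) ∧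
      (ContMDiff 𝓘(ℝ, EP).tangent 𝓘(ℝ, EH) ∞
        fun v : TangentBundle 𝓘(ℝ, EP) P => θ v.proj (modelVec v)) ∧
      ∀ p (k : H) w, θ (p <• k) (modelDeriv 𝓘(ℝ, EP) 𝓘(ℝ, EP) (fun p' : P => p' <• k) p w) =
        adMap EH k⁻¹ (θ p w) := by
  obtain ⟨ϑ, hϑ, hϑfund, hϑs, hϑe⟩ := PrincipalConn.exists_connForm hP A
  obtain ⟨σ, hσ, hσ𝔣, hσsub⟩ := exists_leftInverse_of_isCompl_range
    (IsSmoothEmbedding.modelDeriv_injective hH 1) hcompl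
  -- Both summands 𝔥 and 𝔣 are preserved by Ad(k), so the projection commutes with it.
  have hσAd : ∀ (k : H) (ξ : EG), σ (adMap EG (k : G) ξ) = adMap EH k (σ ξ) := by
    intro k ξ
    have h := hσ𝔣 _ (hAd k _ (hσsub ξ))
    rwa [map_sub, map_sub, ← modelDeriv_val_adMap hH.contMDiff, hσ, sub_eq_zero] at h
  refine ⟨fun p => σ.comp (ϑ p), fun p w => ⟨_, hσsub (ϑ p w), ?_⟩, fun p ζ => ?_, ?_, ?_⟩
  · rw [ContinuousLinearMap.comp_apply, add_sub_cancel, hϑ]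
  · rw [modelFund_subgroup hP.contMDiff_act hH.contMDiff, ContinuousLinearMap.comp_apply, hϑfund,
      hσ]
  · exact σ.contMDiff.comp hϑs
  · intro p k w
    have h := hϑe p (k : G) w
    rw [← Subgroup.coe_inv] at h
    exact (congrArg σ h).trans (hσAd k⁻¹ _)

omit [FiniteDimensional ℝ EG] [LieGroup 𝓘(ℝ, EG) ∞ G] [LieGroup 𝓘(ℝ, EH) ∞ H] in
/-- A connection whose form is the pull-back of the `𝔥`-component of the connection form of `A`. -/
theorem isConstituentConn_of_form {π : P → X} (hP : IsPrincipalBundle EG EP EX G π)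
    (hH : ContMDiff 𝓘(ℝ, EH) 𝓘(ℝ, EG) ∞ (Subtype.val : H → G)) {𝔣 : Submodule ℝ EG}
    {A : Conn EP EX π} {θ : P → EP →L[ℝ] EH}
    (hθ : ∀ p w, ∃ η ∈ 𝔣, w - modelHor A p w = modelFund EG EP G p
        (modelDeriv 𝓘(ℝ, EH) 𝓘(ℝ, EG) (Subtype.val : H → G) 1 (θ p w) + η))
    {EQ EB Q B : Type*} [NormedAddCommGroup EQ] [NormedSpace ℝ EQ]
    [NormedAddCommGroup EB] [NormedSpace ℝ EB]
    [TopologicalSpace Q] [ChartedSpace EQ Q] [IsManifold 𝓘(ℝ, EQ) ∞ Q]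
    [TopologicalSpace B] [ChartedSpace EB B] {ϖ : Q → B} {i : Q → P} {α : Conn EQ EB ϖ}
    (hα : ∀ q w, modelDeriv 𝓘(ℝ, EQ) 𝓘(ℝ, EP) i q (modelHor α q w) =
      modelDeriv 𝓘(ℝ, EQ) 𝓘(ℝ, EP) i q w -
        modelFund EH EP H (i q) (θ (i q) (modelDeriv 𝓘(ℝ, EQ) 𝓘(ℝ, EP) i q w))) :
    IsConstituentConn (subgroupLieAlgebra EG EH H) 𝔣 A i α := by
  intro q (w : EQ)
  obtain ⟨η, hη, h⟩ := hθ (i q) (modelDeriv 𝓘(ℝ, EQ) 𝓘(ℝ, EP) i q w)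
  refine ⟨_, (mem_subgroupLieAlgebra (EG := EG)).2 ⟨_, rfl⟩, η, hη, h, ?_⟩
  change modelDeriv 𝓘(ℝ, EQ) 𝓘(ℝ, EP) i q (w - modelHor α q w) = modelFund EG EP G (i q) _
  rw [map_sub, hα, sub_sub_cancel, modelFund_subgroup hP.contMDiff_act hH]

end Constituent

/-! ### The reduced subbundle -/

section Reduced

variable {EG EH EX EP ES EPh G X P : Type*}
  [NormedAddCommGroup EG] [NormedSpace ℝ EG] [NormedAddCommGroup EH] [NormedSpace ℝ EH]
  [NormedAddCommGroup EX] [NormedSpace ℝ EX] [NormedAddCommGroup EP] [NormedSpace ℝ EP]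
  [NormedAddCommGroup ES] [NormedSpace ℝ ES] [NormedAddCommGroup EPh] [NormedSpace ℝ EPh]
  [Group G] [TopologicalSpace G] [ChartedSpace EG G]
  {H : Subgroup G} [ChartedSpace EH H]
  [TopologicalSpace X] [ChartedSpace EX X]
  [TopologicalSpace P] [ChartedSpace EP P] [MulAction Gᵐᵒᵖ P]

-- The action is smooth into `P`, takes values in the subbundle, and therefore is smooth into this
-- embedded submanifold.
omit [TopologicalSpace X] in
theorem contMDiff_reduced_act {h : X → OrbitSpace H P} [ChartedSpace EPh (Reduced H h)]
    [IsManifold 𝓘(ℝ, EPh) ∞ (Reduced H h)]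
    (hi : IsSmoothEmbedding 𝓘(ℝ, EPh) 𝓘(ℝ, EP) ∞ (Subtype.val : Reduced H h → P))
    (hact : ContMDiff (𝓘(ℝ, EP).prod 𝓘(ℝ, EH)) 𝓘(ℝ, EP) ∞ (fun z : P × H => z.1 <• z.2)) :
    ContMDiff (𝓘(ℝ, EPh).prod 𝓘(ℝ, EH)) 𝓘(ℝ, EPh) ∞
      (fun z : Reduced H h × H => z.1 <• z.2) := by
  have h1 : ContMDiff (𝓘(ℝ, EPh).prod 𝓘(ℝ, EH)) 𝓘(ℝ, EP) ∞
      (fun z : Reduced H h × H => z.1.1 <• z.2) :=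
    hact.comp ((hi.contMDiff.comp contMDiff_fst).prodMk contMDiff_snd)
  exact (ContMDiff.iff_comp_isImmersion hi.isImmersion).2
    ⟨hi.isEmbedding.continuous_iff.2 h1.continuous, h1⟩

-- A point of P^h lies in some orbit h(x), and the section property forces x to be its projection.
omit [TopologicalSpace G] in
theorem HiggsField.orbitMk_reduced {π : P → X} {hπ : ∀ (p : P) (g : G), π (p <• g) = π p}
    [ChartedSpace ES (OrbitSpace H P)] (h : HiggsField EX ES H π hπ) (p : Reduced H h.toFun) :
    orbitMk H p.1 = h.toFun (reducedProj H h.toFun π p) := by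
  obtain ⟨x, hx⟩ := p.2
  have h1 : π p.1 = x := by
    rw [← h.isSection x, hx]
    rfl
  rw [reducedProj, h1, hx]

/-- On P^h the quotient map is h ∘ π, so its derivative kills whatever dπ kills. Vertical vectors of
P^h → X are thereby fundamental vectors of H. -/
theorem HiggsField.modelDeriv_orbitMk_eq_zero {π : P → X} (hP : IsPrincipalBundle EG EP EX G π)
    [ChartedSpace ES (OrbitSpace H P)]
    (hS : IsSubmersion 𝓘(ℝ, EP) 𝓘(ℝ, ES) ∞ (orbitMk H : P → OrbitSpace H P))
    (h : HiggsField EX ES H π hP.proj_act) [ChartedSpace EPh (Reduced H h.toFun)]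
    (hi : ContMDiff 𝓘(ℝ, EPh) 𝓘(ℝ, EP) ∞ (Subtype.val : Reduced H h.toFun → P))
    (q : Reduced H h.toFun) (w : EPh)
    (hw : modelDeriv 𝓘(ℝ, EPh) 𝓘(ℝ, EX) (reducedProj H h.toFun π) q w = 0) :
    modelDeriv 𝓘(ℝ, EP) 𝓘(ℝ, ES) (orbitMk H : P → OrbitSpace H P) q.1
      (modelDeriv 𝓘(ℝ, EPh) 𝓘(ℝ, EP) (Subtype.val : Reduced H h.toFun → P) q w) = 0 := by
  rw [← modelDeriv_comp_apply (hS.contMDiff.mdifferentiableAt (by simp))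
    (hi.mdifferentiableAt (by simp)) rfl]
  simp only [HiggsField.orbitMk_reduced]
  rw [modelDeriv_comp_apply (f := reducedProj H h.toFun π) (h.smooth.mdifferentiableAt (by simp))
    ((hP.contMDiff_proj.comp hi).mdifferentiableAt (by simp)) rfl]
  exact (congrArg _ hw).trans (map_zero _)

end Reduced

end HiggsGauge

end

/-! ### The connections on `P/H` and on the reduced bundles -/

theorem mainTheorem2
    -- the model spaces of `G`, `H`, `X`, `P`, `V`, `P/H` and `(P × V)/H`
    {EG EH EX EP EV ES EY : Type*}
    [NormedAddCommGroup EG] [NormedSpace ℝ EG] [FiniteDimensional ℝ EG]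
    [NormedAddCommGroup EH] [NormedSpace ℝ EH] [FiniteDimensional ℝ EH]
    [NormedAddCommGroup EX] [NormedSpace ℝ EX] [FiniteDimensional ℝ EX]
    [NormedAddCommGroup EP] [NormedSpace ℝ EP] [FiniteDimensional ℝ EP]
    [NormedAddCommGroup EV] [NormedSpace ℝ EV] [FiniteDimensional ℝ EV]
    [NormedAddCommGroup ES] [NormedSpace ℝ ES] [FiniteDimensional ℝ ES]
    [NormedAddCommGroup EY] [NormedSpace ℝ EY] [FiniteDimensional ℝ EY]
    -- the Lie group `G` and its closed Lie subgroup `H`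
    {G : Type*} [Group G] [TopologicalSpace G] [T2Space G] [SecondCountableTopology G]
    [ChartedSpace EG G] [LieGroup 𝓘(ℝ, EG) ∞ G]
    (H : Subgroup G) (hHclosed : IsClosed (H : Set G))
    [ChartedSpace EH H] [LieGroup 𝓘(ℝ, EH) ∞ H]
    (hH : IsSmoothEmbedding 𝓘(ℝ, EH) 𝓘(ℝ, EG) ∞ (Subtype.val : H → G))
    -- the principal `G`-bundle `π : P → X`
    {X : Type*} [TopologicalSpace X] [T2Space X] [SecondCountableTopology X]
    [ChartedSpace EX X] [IsManifold 𝓘(ℝ, EX) ∞ X]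
    {P : Type*} [TopologicalSpace P] [T2Space P] [SecondCountableTopology P]
    [ChartedSpace EP P] [IsManifold 𝓘(ℝ, EP) ∞ P] [MulAction Gᵐᵒᵖ P]
    {π : P → X} (hP : IsPrincipalBundle EG EP EX G π)
    -- the quotient manifold `P/H`
    [ChartedSpace ES (OrbitSpace H P)] [IsManifold 𝓘(ℝ, ES) ∞ (OrbitSpace H P)]
    (hS : IsSubmersion 𝓘(ℝ, EP) 𝓘(ℝ, ES) ∞ (orbitMk H : P → OrbitSpace H P))
    -- the typical fibre `V`, a manifold with a smooth left action of `H`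
    {V : Type*} [TopologicalSpace V] [T2Space V] [SecondCountableTopology V]
    [ChartedSpace EV V] [IsManifold 𝓘(ℝ, EV) ∞ V] [MulAction H V]
    [ContMDiffSMul 𝓘(ℝ, EH) 𝓘(ℝ, EV) ∞ H V]
    -- the quotient manifold `Y = (P × V)/H`
    [ChartedSpace EY (Assoc H P V)] [IsManifold 𝓘(ℝ, EY) ∞ (Assoc H P V)]
    (hY : IsSubmersion (𝓘(ℝ, EP).prod 𝓘(ℝ, EV)) 𝓘(ℝ, EY) ∞ (assocMk H : P × V → Assoc H P V))
    -- the decomposition `𝔤 = 𝔥 ⊕ 𝔣`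
    (𝔣 : Submodule ℝ (GroupLieAlgebra 𝓘(ℝ, EG) G))
    (hcompl : IsCompl (subgroupLieAlgebra EG EH H) 𝔣)
    (hbracket : ∀ ξ ∈ subgroupLieAlgebra EG EH H, ∀ η ∈ 𝔣, ⁅ξ, η⁆ ∈ 𝔣)
    -- every connected component of `H` has an element preserving `𝔣` (void if `H` is connected)
    (hcomponents : ∀ k : H, ∃ k' ∈ connectedComponent k, ∀ η ∈ 𝔣, Ad EG (k' : G) η ∈ 𝔣)
    -- the `G`-connection
    (A : PrincipalConn EP EX G π) :
    ∃ (AS : PrincipalConn EP ES H (orbitMk H : P → OrbitSpace H P))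
      (AY : Conn EY ES (assocProj V (orbitMk H : P → OrbitSpace H P) orbitMk_act)),
      IsConstituentConn (subgroupLieAlgebra EG EH H) 𝔣 A.toConn id AS.toConn ∧
      IsAssociatedConn (EV := EV) AS AY ∧
      ∀ h : HiggsField EX ES H π hP.proj_act,
      -- the reduced subbundle `P^h` as an embedded submanifold of `P`
      ∀ {EPh : Type*} [NormedAddCommGroup EPh] [NormedSpace ℝ EPh] [FiniteDimensional ℝ EPh]
        [ChartedSpace EPh (Reduced H h.toFun)] [IsManifold 𝓘(ℝ, EPh) ∞ (Reduced H h.toFun)],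
      IsSmoothEmbedding 𝓘(ℝ, EPh) 𝓘(ℝ, EP) ∞ (Subtype.val : Reduced H h.toFun → P) →
      -- the quotient manifold `Y^h = (P^h × V)/H`
      ∀ {EYh : Type*} [NormedAddCommGroup EYh] [NormedSpace ℝ EYh] [FiniteDimensional ℝ EYh]
        [ChartedSpace EYh (Assoc H (Reduced H h.toFun) V)]
        [IsManifold 𝓘(ℝ, EYh) ∞ (Assoc H (Reduced H h.toFun) V)],
      IsSubmersion (𝓘(ℝ, EPh).prod 𝓘(ℝ, EV)) 𝓘(ℝ, EYh) ∞
        (assocMk H : Reduced H h.toFun × V → Assoc H (Reduced H h.toFun) V) →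
      ∃ (Ah : PrincipalConn EPh EX H (reducedProj H h.toFun π))
        (AYh : Conn EYh EX (assocProj V (reducedProj H h.toFun π)
          (reducedProj_act H h.toFun π hP.proj_act))),
        IsConstituentConn (subgroupLieAlgebra EG EH H) 𝔣 A.toConn
          (Subtype.val : Reduced H h.toFun → P) Ah.toConn ∧
        IsPullbackConn (Subtype.val : Reduced H h.toFun → P) AS.toConn Ah.toConn ∧
        IsAssociatedConn (EV := EV) Ah AYh ∧
        IsPullbackConn
          (assocMap V (Subtype.val : Reduced H h.toFun → P) (reduced_val_act H h.toFun))
          AY AYh := by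
  have hAd : ∀ (k : H), ∀ η ∈ (𝔣 : Submodule ℝ EG), adMap EG (k : G) η ∈ (𝔣 : Submodule ℝ EG) :=
    fun k η hη => adMap_mem_of_bracket_mem hH.contMDiff (𝔣 : Submodule ℝ EG)
      (fun ξ η hη => hbracket _ ⟨ξ, rfl⟩ η hη) hcomponents k hη
  obtain ⟨θ, hθ, hθfund, hθs, hθe⟩ :=
    PrincipalConn.exists_constituent_form (𝔣 := (𝔣 : Submodule ℝ EG)) hP hH hcompl hAd A
  have hact := contMDiff_subgroup_act hP.contMDiff_act hH.contMDiff
  have hid : ∀ (p : P) (w : EP), modelDeriv 𝓘(ℝ, EP) 𝓘(ℝ, EP) id p w = w := fun p w =>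
    congrArg (fun L => L w) (modelDeriv_id (I := 𝓘(ℝ, EP)) p)
  obtain ⟨AS, hAS⟩ := exists_principalConn_of_connForm (i := (id : P → P)) hact hact contMDiff_id
    (fun _ _ => rfl) (fun p w w' hw => by rwa [hid, hid] at hw) hS.contMDiff orbitMk_act
    (fun p w hw => by
      rw [hid]
      exact exists_modelFund_eq_of_modelDeriv_orbitMk_eq_zero hP hH hS p w hw) hθfund hθs hθe
  obtain ⟨AY, hAY⟩ := exists_associatedConn hact hS.contMDiff orbitMk_act hY AS
  refine ⟨AS, AY, isConstituentConn_of_form hP hH.contMDiff hθ hAS, hAY, ?_⟩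
  intro h EPh _ _ _ _ _ hi EYh _ _ _ _ _ hYh
  have hacth := contMDiff_reduced_act hi hact
  have hprojh : ContMDiff 𝓘(ℝ, EPh) 𝓘(ℝ, EX) ∞ (reducedProj H h.toFun π) :=
    hP.contMDiff_proj.comp hi.contMDiff
  -- The same form θ is used, now along the inclusion of P^h.
  obtain ⟨Ah, hAh⟩ := exists_principalConn_of_connForm hact hacth hi.contMDiff
    (reduced_val_act H h.toFun) (IsSmoothEmbedding.modelDeriv_injective hi) hprojh
    (reducedProj_act H h.toFun π hP.proj_act)
    (fun q w hw => exists_modelFund_eq_of_modelDeriv_orbitMk_eq_zero hP hH hS _ _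
      (HiggsField.modelDeriv_orbitMk_eq_zero hP hS h hi.contMDiff q w hw)) hθfund hθs hθe
  obtain ⟨AYh, hAYh⟩ := exists_associatedConn hacth hprojh
    (reducedProj_act H h.toFun π hP.proj_act) hYh Ah
  -- After applying the differential of the inclusion, both projectors subtract the fundamental
  -- vector of the same value of θ.
  have hpull : IsPullbackConn (Subtype.val : Reduced H h.toFun → P) AS.toConn Ah.toConn := by
    intro q w
    have h1 := hAS q.1 (modelDeriv 𝓘(ℝ, EPh) 𝓘(ℝ, EP) (Subtype.val : Reduced H h.toFun → P) q w)
    rw [hid, hid] at h1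
    exact (hAh q w).trans h1.symm
  exact ⟨Ah, AYh, isConstituentConn_of_form hP hH.contMDiff hθ hAh, hpull, hAYh,
    hpull.assoc hY hYh hAY hAYh hi.contMDiff (reduced_val_act H h.toFun)⟩
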